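/- **Model.** Let $n\ge 1$ point robots have initial positions $x=(x_1,\dots,x_n)\in(\mathbb{R}^2)^n$, measured in units of the communication range, $x_1$ being that of the leader. At time $0$ the leader is awake (has the information). A robot awakes as soon as it is at distance at most $1$ from an awake robot; asleep robots do not move, awake robots move in the plane with speed at most $1$. $\mathrm{OPT}(x)$ is the infimum, over all such joint motions (chosen with full knowledge of $x$), of the time at which the last robot is awakened. In a deterministic *online algorithm* $A$ the displacement of a robot at time $t$ is a function only of what it has known up to time $t$: the awakening times, the initial positions relative to its own, and the leader/non-leader status of the robots about which it has been told, where an awake robot knows about itself and knowledge is exchanged between robots within distance $1$. In particular, the algorithm knows neither $n$ nor the positions of robots not yet found. $A(x)$ is the time at which $A$ awakens the last robot. $M(x)$ is the largest edge length in a Euclidean minimum spanning tree of the points $x_1,\dots,x_n$. **Theorem.** There is an online algorithm that is $O(M)$-competitive, in expectation, in the (unbounded) plane when the robots' initial positions are chosen uniformly at random in an unknown disk. That is, there are an online algorithm $A$ and an absolute constant $C$ such that for every $n\ge1$ and every open disk of arbitrary centre and radius $L>0$, none of which is known to $A$, if $x_1,\dots,x_n$ are independent and uniformly distributed in the disk,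 then $$\mathbb{E}\left[\frac{A(x)}{M(x)\,\mathrm{OPT}(x)}\right]\le C\qquad\text{and}\qquad \mathbb{E}[A(x)]\le C\;\mathbb{E}\left[M(x)\,\mathrm{OPT}(x)\right],$$ where the quotient is read as $0$ if $A(x)=0$ and as $\infty$ if $A(x)>0=M(x)\,\mathrm{OPT}(x)$. -/

import Mathlib

open scoped NNReal ENNReal
open MeasureTheory

noncomputable section

namespace ONFP

/-- The (unbounded) environment. Distances are measured in units of the communication range. -/
abbrev Plane := EuclideanSpace ℝ (Fin 2)

/-- Initial positions of `n + 1` robots; robot `0` is the leader. -/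
abbrev Configuration (n : ℕ) := Fin (n + 1) → Plane

/-- A joint motion of the robots: the position of every robot at every time. -/
abbrev Motion (n : ℕ) := Fin (n + 1) → ℝ≥0 → Plane

/-- `Awake p i t`: in the motion `p`, robot `i` has received the information by time `t`.
The leader has it from the start, it is never lost, and an asleep robot receives it as soon as
an active robot is within distance `1` (and may then pass it on itself). -/
inductive Awake {n : ℕ} (p : Motion n) : Fin (n + 1) → ℝ≥0 → Prop
  | leader : Awake p 0 0
  | stay {i : Fin (n + 1)} {s t : ℝ≥0} : s ≤ t → Awake p i s → Awake p i t
  | tag {i j : Fin (n + 1)} {t : ℝ≥0} :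
      Awake p j t → dist (p j t) (p i t) ≤ 1 → Awake p i t

/-- The motions that the robots can execute from the initial positions `x`: every robot has
speed at most one (one communication range per time unit), and asleep robots do not move. -/
structure IsAdmissible {n : ℕ} (x : Configuration n) (p : Motion n) : Prop where
  start : ∀ i, p i 0 = x i
  speed : ∀ i, LipschitzWith 1 (p i)
  asleep : ∀ i t, ¬ Awake p i t → p i t = x i

/-- The time at which robot `i` is tagged (`⊤` if never). -/
def wakeTime {n : ℕ} (p : Motion n) (i : Fin (n + 1)) : ℝ≥0∞ :=
  ⨅ (t : ℝ≥0) (_ : Awake p i t), (t : ℝ≥0∞)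

/-- The time at which the last robot is tagged (`⊤` if some robot is never tagged). -/
def finishTime {n : ℕ} (p : Motion n) : ℝ≥0∞ :=
  ⨆ i, wakeTime p i

/-- The optimal offline value: the infimum of the finishing time over all motions that the robots
can execute; these may be chosen with full knowledge of the initial positions. -/
def opt {n : ℕ} (x : Configuration n) : ℝ≥0∞ :=
  ⨅ (p : Motion n) (_ : IsAdmissible x p), finishTime p

/-- `Knows p i k t`: by time `t`, robot `i` has been told about the awakening of robot `k`.
An awake robot knows about its own awakening, and knowledge is exchanged exactly between
robots within communication range. -/
inductive Knows {n : ℕ} (p : Motion n) : Fin (n + 1) → Fin (n + 1) → ℝ≥0 → Prop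
  | self {i : Fin (n + 1)} {t : ℝ≥0} : Awake p i t → Knows p i i t
  | stay {i k : Fin (n + 1)} {s t : ℝ≥0} : s ≤ t → Knows p i k s → Knows p i k t
  | exchange {i j k : Fin (n + 1)} {t : ℝ≥0} :
      Knows p j k t → dist (p j t) (p i t) ≤ 1 → Knows p i k t

/-- What robot `i` knows at time `t`: for every robot `k` whose awakening it has been told about,
the displacement from its own initial position to that of `k`, the time at which `k` was tagged,
and whether `k` is the leader. Robots are anonymous, share a clock and a compass, and know neither
absolute positions nor the number of robots. -/
def view {n : ℕ} (x : Configuration n) (p : Motion n) (i : Fin (n + 1)) (t : ℝ≥0) :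
    Set (Plane × ℝ≥0∞ × Bool) :=
  {e | ∃ k, Knows p i k t ∧ e = (x k - x i, wakeTime p k, decide (k = 0))}

/-- A (deterministic) online algorithm. On every instance it produces an executable motion, and
the displacement of a robot at time `t` is a function of what the robot has known up to time `t`:
if two robots, possibly in different instances with different numbers of robots, have had the same
knowledge at all times up to `t`, then they have made the same displacement at time `t`. -/
structure OnlineAlgorithm where
  run : ∀ {n : ℕ}, Configuration n → Motion n
  admissible : ∀ {n : ℕ} (x : Configuration n), IsAdmissible x (run x)
  online : ∀ {n m : ℕ} (x : Configuration n) (y : Configuration m)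
    (i : Fin (n + 1)) (j : Fin (m + 1)) (t : ℝ≥0),
    (∀ s ≤ t, view x (run x) i s = view y (run y) j s) →
      run x i t - x i = run y j t - y j

/-- The value of the algorithm on an instance: the time at which the last robot is tagged. -/
def OnlineAlgorithm.cost (A : OnlineAlgorithm) {n : ℕ} (x : Configuration n) : ℝ≥0∞ :=
  finishTime (A.run x)

/-- The Euclidean length of an edge between two robots' initial positions. -/
def edgeLength {n : ℕ} (x : Configuration n) : Sym2 (Fin (n + 1)) → ℝ≥0 :=
  Sym2.lift ⟨fun i j => nndist (x i) (x j), fun i j => nndist_comm (x i) (x j)⟩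

open Classical in
/-- The total edge length of a graph on the robots. -/
def totalLength {n : ℕ} (x : Configuration n) (T : SimpleGraph (Fin (n + 1))) : ℝ≥0 :=
  ∑ e ∈ T.edgeFinset, edgeLength x e

/-- `T` is a Euclidean minimum spanning tree of the initial positions. -/
def IsMST {n : ℕ} (x : Configuration n) (T : SimpleGraph (Fin (n + 1))) : Prop :=
  T.IsTree ∧ ∀ T' : SimpleGraph (Fin (n + 1)), T'.IsTree → totalLength x T ≤ totalLength x T'

/-- The length of the longest edge of a Euclidean minimum spanning tree (`0` for one robot). It does
not depend on the choice of the tree; the infimum is over all minimum spanning trees. -/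
def longestEdge {n : ℕ} (x : Configuration n) : ℝ≥0∞ :=
  ⨅ (T : SimpleGraph (Fin (n + 1))) (_ : IsMST x T), ⨆ e ∈ T.edgeSet, (edgeLength x e : ℝ≥0∞)

/-- The law of `n + 1` independent uniform points in the open disk of centre `c` and radius `L`. -/
def uniformDeployment (n : ℕ) (c : Plane) (L : ℝ) : Measure (Configuration n) :=
  Measure.pi fun _ => ProbabilityTheory.cond volume (Metric.ball c L)

/-- The upper expectation: the infimum of the expectations of the measurable majorants. It is the
expectation when `f` is measurable. -/
def upperExpectation {Ω : Type*} [MeasurableSpace Ω] (μ : Measure Ω) (f : Ω → ℝ≥0∞) : ℝ≥0∞ :=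
  ⨅ (g : Ω → ℝ≥0∞) (_ : Measurable g) (_ : ∀ ω, f ω ≤ g ω), ∫⁻ ω, g ω ∂μ

end ONFP

end

/-! The algorithm lets every robot, once awake, run the same spiral around its own starting point.
The spiral meets the unit disk about a target at distance `d` by time `36 (d - 1) d`, truncated at
`0` (`exists_dist_search_le`). Tagging times are then first-passage times for a weight at most `36
(d - 1) d`. The offline optimum is at least the largest first-passage time for the weight `d - 1`
(`maxGapTime_le_opt`), and the longest tree edge is at least the largest distance `b` between
complementary groups of robots (`cutValue_le_longestEdge`). So it is enough to compare the cost with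
the measurable quantity `benchmark`, the product of these two lower bounds.

Deterministically the cost is at most `36 n` times the benchmark (`tagTime_le_benchmark`). If long
edges can be replaced by hops of length at most `5 R`, each gaining `R`, the cost is `O(R)` times
the offline first-passage time (`HasHops.tagTime_le`). This is within a constant of the benchmark
when `R = O(b)`.

For random points, take a grid of side `s ≥ 1` with `s ^ 2 (n + 1) = ℓ L ^ 2` and `ℓ ≥ 8 log (n +
1)`, so that the average load of a cell inside the disk is `ℓ / π`. Except with probability `exp
(-33 ℓ)`, fewer than 200 such cells are empty, and hops exist with `R = 800 s`. If `s = 1`, nothing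
more is needed: either `b ≤ 1` and the cost is zero, or `b > 1` and `R ≤ 800 b`. Otherwise, again up
to `exp (-33 ℓ)`, some occupied cell keeps all its robots away from its boundary, which forces `b ≥
s / 2000`.

The bound on the quotient only needs the failure probability to be `O(1 / n)`. The bound on
expectations needs more, because in a dense disk the offline optimum is usually zero and its mean
can be exponentially small. Isolating the leader shows that the benchmark has mean at least `6 s ^ 2
(s ^ 2 / L ^ 2) exp (-32 ℓ)` (`le_lintegral_benchmark`). The spare factor `exp (-ℓ)` in the failure
probability absorbs the polynomial losses. -/

noncomputable section

namespace ONFP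

/-! ### First passage percolation on a finite set -/

section FirstPassage

variable {n : ℕ}

/-- The length of the path from `a` to `b` that visits the points of the list in order. -/
def pathCost (w : Fin (n + 1) → Fin (n + 1) → ℝ≥0) :
    Fin (n + 1) → List (Fin (n + 1)) → Fin (n + 1) → ℝ≥0
  | a, [], b => w a b
  | a, c :: l, b => w a c + pathCost w c l b

/-- The first-passage time from `0`. -/
def firstPassage (w : Fin (n + 1) → Fin (n + 1) → ℝ≥0) (i : Fin (n + 1)) : ℝ≥0 :=
  ⨅ l : List (Fin (n + 1)), pathCost w 0 l i

lemma pathCost_append_singleton (w : Fin (n + 1) → Fin (n + 1) → ℝ≥0) (l : List (Fin (n + 1)))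
    (a j i : Fin (n + 1)) : pathCost w a (l ++ [j]) i = pathCost w a l j + w j i := by
  induction l generalizing a with
  | nil => rfl
  | cons c l ih => simp [pathCost, ih, add_assoc]

lemma firstPassage_le_pathCost (w : Fin (n + 1) → Fin (n + 1) → ℝ≥0) (l : List (Fin (n + 1)))
    (i : Fin (n + 1)) : firstPassage w i ≤ pathCost w 0 l i :=
  ciInf_le (OrderBot.bddBelow _) l

lemma firstPassage_le_add (w : Fin (n + 1) → Fin (n + 1) → ℝ≥0) (j i : Fin (n + 1)) :
    firstPassage w i ≤ firstPassage w j + w j i := by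
  rw [← tsub_le_iff_right]
  refine le_ciInf fun l => ?_
  rw [tsub_le_iff_right, ← pathCost_append_singleton]
  exact firstPassage_le_pathCost w _ i

lemma firstPassage_zero {w : Fin (n + 1) → Fin (n + 1) → ℝ≥0} (h : w 0 0 = 0) :
    firstPassage w 0 = 0 :=
  le_antisymm ((firstPassage_le_pathCost w [] 0).trans h.le) zero_le

lemma le_add_pathCost {w : Fin (n + 1) → Fin (n + 1) → ℝ≥0} {f : Fin (n + 1) → ℝ≥0}
    (hf : ∀ a b, f b ≤ f a + w a b) (l : List (Fin (n + 1))) (a b : Fin (n + 1)) :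
    f b ≤ f a + pathCost w a l b := by
  induction l generalizing a with
  | nil => exact hf a b
  | cons c l ih =>
    calc f b ≤ f c + pathCost w c l b := ih c
      _ ≤ f a + w a c + pathCost w c l b := by gcongr; exact hf a c
      _ = f a + pathCost w a (c :: l) b := by simp [pathCost, add_assoc]

/-- First-passage time is the largest potential vanishing at the origin. -/
lemma le_firstPassage {w : Fin (n + 1) → Fin (n + 1) → ℝ≥0} {f : Fin (n + 1) → ℝ≥0}
    (h0 : f 0 = 0) (hf : ∀ a b, f b ≤ f a + w a b) (i : Fin (n + 1)) :
    f i ≤ firstPassage w i :=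
  le_ciInf fun l => by simpa [h0] using le_add_pathCost hf l 0 i

/-- Dijkstra's principle: a set that contains the origin and absorbs every point whose passage time
is attained through an edge from the set is everything. -/
lemma firstPassage_induction {w : Fin (n + 1) → Fin (n + 1) → ℝ≥0} (R : Set (Fin (n + 1)))
    (h0 : 0 ∈ R) (hw : w 0 0 = 0)
    (hR : ∀ a ∈ R, ∀ b, firstPassage w b = firstPassage w a + w a b → b ∈ R) : R = Set.univ := by
  classical
  by_contra hne
  obtain ⟨c, hc⟩ := (Set.ne_univ_iff_exists_notMem _).1 hne
  let S : Finset (Fin (n + 1) × Fin (n + 1)) :=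
    Finset.univ.filter fun p => p.1 ∈ R ∧ p.2 ∉ R
  have hS : S.Nonempty := ⟨(0, c), by simp [S, h0, hc]⟩
  obtain ⟨⟨a, b⟩, hab, hmin⟩ :=
    S.exists_min_image (fun p => firstPassage w p.1 + w p.1 p.2) hS
  simp only [S, Finset.mem_filter, Finset.mem_univ, true_and] at hab hmin
  set m := firstPassage w a + w a b with hm
  have key : m ≤ firstPassage w b := by
    -- The passage time is capped at `m` inside `R` and set to `m` outside. Since `m` is the least
    -- value over edges leaving `R`, this is still a potential, so no point outside `R` is reached
    -- before `m`.
    have := le_firstPassage (w := w) (f := fun i => if i ∈ R then min (firstPassage w i) m else m)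
      (by simp [h0, firstPassage_zero hw]) (fun i j => ?_) b
    · simpa [hab.2] using this
    · by_cases hi : i ∈ R <;> by_cases hj : j ∈ R <;> simp only [hi, hj, if_true, if_false]
      · rw [min_add]
        exact min_le_min (firstPassage_le_add w i j) le_self_add
      · rw [min_add]
        exact le_min (hmin (i, j) ⟨hi, hj⟩) le_self_add
      · exact (min_le_right _ _).trans le_self_add
      · exact le_self_add
  exact hab.2 (hR a hab.1 b (le_antisymm (firstPassage_le_add w a b) key))

end FirstPassage

/-! ### The search curve -/

/-- The radius of the search curve at time `s`. -/
def searchRadius (s : ℝ) : ℝ := √(1 + s / 4) - 1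

/-- The polar angle of the search curve at radius `ρ`: the curve is a logarithmic spiral at small
scales and an Archimedean one at large scales. -/
def searchAngle (ρ : ℝ) : ℝ := 2 * Real.pi * (Real.log ρ + ρ)

/-- The search curve in the complex plane, parametrised by its radius. -/
def radialCurve (ρ : ℝ) : ℂ := ρ * Complex.exp (Complex.I * searchAngle ρ)

lemma norm_exp_sub_exp_le (a b : ℝ) :
    ‖Complex.exp (Complex.I * a) - Complex.exp (Complex.I * b)‖ ≤ |a - b| := by
  have : Complex.exp (Complex.I * a) - Complex.exp (Complex.I * b) =
      Complex.exp (Complex.I * b) * (Complex.exp (Complex.I * ((a - b : ℝ) : ℂ)) - 1) := by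
    rw [mul_sub, ← Complex.exp_add]
    push_cast
    ring_nf
  rw [this, norm_mul, mul_comm Complex.I (b : ℂ), Complex.norm_exp_ofReal_mul_I, one_mul]
  exact Real.norm_exp_I_mul_ofReal_sub_one_le

/-- Per unit of radius the curve moves `1` radially and about `2π (1 + ρ)` tangentially, and `1 + 2π
≤ 8`. The factor `ρ₁` cancels the singularity of the logarithm at the origin. The bound is at most
the increment of `4 (ρ ^ 2 + 2 ρ)`, whose inverse function is `searchRadius`; hence the
time-parametrised curve has speed at most one. -/
lemma norm_radialCurve_sub_le {ρ₁ ρ₂ : ℝ} (h1 : 0 ≤ ρ₁) (h2 : ρ₁ ≤ ρ₂) :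
    ‖radialCurve ρ₂ - radialCurve ρ₁‖ ≤ 8 * (ρ₂ - ρ₁) * (1 + ρ₁) := by
  have e : radialCurve ρ₂ - radialCurve ρ₁ =
      ((ρ₂ - ρ₁ : ℝ) : ℂ) * Complex.exp (Complex.I * searchAngle ρ₂) +
      ρ₁ * (Complex.exp (Complex.I * searchAngle ρ₂) -
        Complex.exp (Complex.I * searchAngle ρ₁)) := by
    simp only [radialCurve]; push_cast; ring
  have hn : ‖Complex.exp (Complex.I * searchAngle ρ₂)‖ = 1 := by
    rw [mul_comm, Complex.norm_exp_ofReal_mul_I]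
  have hpi := Real.pi_lt_d2
  have hang : ρ₁ * |searchAngle ρ₂ - searchAngle ρ₁| ≤
      2 * Real.pi * (ρ₂ - ρ₁) * (1 + ρ₁) := by
    rcases h1.eq_or_lt with h | h
    · rw [← h]; simp
      have := Real.pi_pos
      exact mul_nonneg (by positivity) (by linarith)
    · have hl := Real.log_le_sub_one_of_pos (div_pos (h.trans_le h2) h)
      rw [Real.log_div (by linarith) (by linarith)] at hl
      have hmono := Real.log_le_log h h2
      have hl' : ρ₁ * (Real.log ρ₂ - Real.log ρ₁) ≤ ρ₂ - ρ₁ := by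
        calc _ ≤ ρ₁ * (ρ₂ / ρ₁ - 1) := by gcongr
          _ = _ := by field_simp
      rw [abs_of_nonneg]
      · simp only [searchAngle]
        have := mul_le_mul_of_nonneg_left hl' (show 0 ≤ 2 * Real.pi by positivity)
        nlinarith
      · simp only [searchAngle]
        have : 0 ≤ 2 * Real.pi * ((Real.log ρ₂ - Real.log ρ₁) + (ρ₂ - ρ₁)) :=
          mul_nonneg (by positivity) (by linarith)
        linarith
  calc ‖radialCurve ρ₂ - radialCurve ρ₁‖
      ≤ (ρ₂ - ρ₁) + ρ₁ * |searchAngle ρ₂ - searchAngle ρ₁| := by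
        rw [e]
        refine (norm_add_le _ _).trans ?_
        rw [norm_mul, norm_mul, hn, mul_one, Complex.norm_real, Complex.norm_real,
          Real.norm_of_nonneg h1, Real.norm_of_nonneg (sub_nonneg.2 h2)]
        gcongr
        exact norm_exp_sub_exp_le _ _
    _ ≤ (ρ₂ - ρ₁) + 2 * Real.pi * (ρ₂ - ρ₁) * (1 + ρ₁) := by gcongr
    _ ≤ 8 * (ρ₂ - ρ₁) * (1 + ρ₁) := by
        have h3 : 0 ≤ (ρ₂ - ρ₁) * (1 + ρ₁) := mul_nonneg (by linarith) (by linarith)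
        have h4 : 0 ≤ (ρ₂ - ρ₁) * ρ₁ := mul_nonneg (by linarith) h1
        nlinarith

lemma searchRadius_nonneg {s : ℝ} (hs : 0 ≤ s) : 0 ≤ searchRadius s := by
  have : (1 : ℝ) ≤ √(1 + s / 4) := Real.one_le_sqrt.2 (by linarith)
  simp only [searchRadius]; linarith

lemma searchRadius_mono {s t : ℝ} (h : s ≤ t) : searchRadius s ≤ searchRadius t := by
  simp only [searchRadius]; gcongr

lemma searchRadius_sq {s : ℝ} (hs : 0 ≤ s) :
    4 * (searchRadius s ^ 2 + 2 * searchRadius s) = s := by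
  have := Real.sq_sqrt (show 0 ≤ 1 + s / 4 by linarith)
  simp only [searchRadius]; nlinarith

lemma searchRadius_apply {ρ : ℝ} (hρ : 0 ≤ ρ) : searchRadius (4 * (ρ ^ 2 + 2 * ρ)) = ρ := by
  have : 1 + 4 * (ρ ^ 2 + 2 * ρ) / 4 = (ρ + 1) ^ 2 := by ring
  rw [searchRadius, this, Real.sqrt_sq (by linarith)]; ring

/-- The search curve. -/
def search (s : ℝ≥0) : Plane :=
  Complex.orthonormalBasisOneI.repr (radialCurve (searchRadius s))

@[simp] lemma search_zero : search 0 = 0 := by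
  simp [search, searchRadius, radialCurve]

lemma lipschitzWith_search : LipschitzWith 1 search := by
  have key : ∀ s t : ℝ≥0, s ≤ t → dist (search t) (search s) ≤ (t : ℝ) - s := by
    intro s t hst
    have h1 := searchRadius_nonneg s.2
    have h2 := searchRadius_mono (NNReal.coe_le_coe.2 hst)
    have e1 := searchRadius_sq s.2
    have e2 := searchRadius_sq t.2
    rw [search, search, LinearIsometryEquiv.dist_map, dist_eq_norm]
    refine (norm_radialCurve_sub_le h1 h2).trans ?_
    simp only [NNReal.val_eq_coe] at *
    nlinarith [mul_nonneg (sub_nonneg.2 h2) (sub_nonneg.2 h2)]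
  refine LipschitzWith.of_dist_le_mul fun s t => ?_
  rw [NNReal.coe_one, one_mul, NNReal.dist_eq]
  rcases le_total s t with h | h
  · rw [dist_comm, abs_sub_comm]; exact (key s t h).trans (le_abs_self _)
  · exact (key t s h).trans (le_abs_self _)

/-- Between `ε` and `min (3 ε) (ε + 2)` the angle gains a full turn: tripling the radius adds `log 3
≥ 1` to the logarithmic term, and adding `2` gains enough from the linear term. The intermediate
value theorem then gives every direction. -/
lemma exists_searchAngle_eq {ε : ℝ} (hε : 0 < ε) (α : ℝ) :
    ∃ ρ, ε ≤ ρ ∧ ρ ≤ 3 * ε ∧ ρ ≤ ε + 2 ∧ ∃ k : ℤ, searchAngle ρ = α + k * (2 * Real.pi) := by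
  have hpi := Real.pi_pos
  set k : ℤ := ⌈(searchAngle ε - α) / (2 * Real.pi)⌉ with hk
  have hk1 : searchAngle ε ≤ α + k * (2 * Real.pi) := by
    have := Int.le_ceil ((searchAngle ε - α) / (2 * Real.pi))
    rw [div_le_iff₀ (by positivity)] at this
    linarith
  have hk2 : α + k * (2 * Real.pi) ≤ searchAngle ε + 2 * Real.pi := by
    have := (Int.ceil_lt_add_one ((searchAngle ε - α) / (2 * Real.pi))).le
    rw [← sub_le_iff_le_add, le_div_iff₀ (by positivity)] at this
    linarith
  set ρ₁ := min (3 * ε) (ε + 2) with hρ₁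
  have hle : ε ≤ ρ₁ := le_min (by linarith) (by linarith)
  have hend : searchAngle ε + 2 * Real.pi ≤ searchAngle ρ₁ := by
    have : Real.log ε + ε + 1 ≤ Real.log ρ₁ + ρ₁ := by
      rcases le_total (3 * ε) (ε + 2) with h | h
      · rw [hρ₁, min_eq_left h, Real.log_mul (by norm_num) hε.ne']
        have : 1 ≤ Real.log 3 := by
          rw [Real.le_log_iff_exp_le (by norm_num)]
          exact (Real.exp_one_lt_d9.trans (by norm_num)).le
        linarith
      · rw [hρ₁, min_eq_right h]
        have := Real.log_le_log hε (show ε ≤ ε + 2 by linarith)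
        linarith
    simp only [searchAngle]
    nlinarith
  have hcont : ContinuousOn searchAngle (Set.Icc ε ρ₁) := by
    unfold searchAngle
    refine continuousOn_const.mul (ContinuousOn.add (Real.continuousOn_log.mono ?_) continuousOn_id)
    intro x hx
    exact (lt_of_lt_of_le hε hx.1).ne'
  obtain ⟨ρ, hρ, hρe⟩ := intermediate_value_Icc hle hcont ⟨hk1, hk2.trans hend⟩
  exact ⟨ρ, hρ.1, hρ.2.trans (min_le_left _ _), hρ.2.trans (min_le_right _ _), k, hρe⟩

/-- The search curve comes within distance one of `v` by time `36 (‖v‖ - 1) ‖v‖`. -/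
lemma exists_dist_search_le (v : Plane) :
    ∃ s : ℝ≥0, s ≤ 36 * ((‖v‖₊ - 1) * ‖v‖₊) ∧ dist (search s) v ≤ 1 := by
  rcases le_or_gt ‖v‖₊ 1 with h | h
  · exact ⟨0, by simp, by simpa [dist_eq_norm] using NNReal.coe_le_coe.2 h⟩
  have h' : 1 < ‖v‖ := h
  set z : ℂ := Complex.orthonormalBasisOneI.repr.symm v with hz
  have hzn : ‖z‖ = ‖v‖ := LinearIsometryEquiv.norm_map _ _
  -- With `ε = ‖v‖ - 1` the radius lies within one of `‖v‖` in the direction of `v`. The bound `ρ ≤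
  -- 3 ε` also gives `ρ + 2 ≤ 3 ‖v‖`, so the time `4 ρ (ρ + 2)` is at most `36 (‖v‖ - 1) ‖v‖`.
  obtain ⟨ρ, h1, h2, h3, k, hk⟩ := exists_searchAngle_eq (sub_pos.2 h') z.arg
  have hρ : 0 ≤ ρ := by linarith
  obtain ⟨s, hs⟩ : ∃ s : ℝ≥0, (s : ℝ) = 4 * (ρ ^ 2 + 2 * ρ) :=
    ⟨Real.toNNReal _, Real.coe_toNNReal _ (by positivity)⟩
  refine ⟨s, ?_, ?_⟩
  · rw [← NNReal.coe_le_coe]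
    push_cast [NNReal.coe_sub h.le]
    rw [hs]
    nlinarith
  · have e : radialCurve ρ - z = ((ρ - ‖v‖ : ℝ) : ℂ) * Complex.exp (Complex.I * z.arg) := by
      have hexp : Complex.exp (Complex.I * searchAngle ρ) = Complex.exp (Complex.I * z.arg) := by
        rw [hk, Complex.exp_eq_exp_iff_exists_int]
        exact ⟨k, by push_cast; ring⟩
      conv_lhs => rw [← Complex.norm_mul_exp_arg_mul_I z]
      rw [radialCurve, hexp, hzn, mul_comm (Complex.arg z : ℂ)]
      push_cast
      ring
    rw [search, hs, searchRadius_apply hρ,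
      ← Complex.orthonormalBasisOneI.repr.apply_symm_apply v, LinearIsometryEquiv.dist_map,
      dist_eq_norm, ← hz, e, norm_mul, mul_comm Complex.I, Complex.norm_exp_ofReal_mul_I, mul_one,
      Complex.norm_real, Real.norm_eq_abs, abs_le]
    constructor <;> linarith

/-- The first time at which the search curve is within distance one of `v`. -/
def searchTime (v : Plane) : ℝ≥0 := sInf {s | dist (search s) v ≤ 1}

lemma dist_search_searchTime (v : Plane) : dist (search (searchTime v)) v ≤ 1 := by
  have hc : IsClosed {s | dist (search s) v ≤ 1} :=
    isClosed_le (lipschitzWith_search.continuous.dist continuous_const) continuous_const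
  obtain ⟨s, -, hs⟩ := exists_dist_search_le v
  exact hc.csInf_mem ⟨s, hs⟩ (OrderBot.bddBelow _)

lemma searchTime_le {v : Plane} {s : ℝ≥0} (h : dist (search s) v ≤ 1) : searchTime v ≤ s :=
  csInf_le (OrderBot.bddBelow _) h

lemma searchTime_le_mul (v : Plane) : searchTime v ≤ 36 * ((‖v‖₊ - 1) * ‖v‖₊) := by
  obtain ⟨s, hs, hd⟩ := exists_dist_search_le v
  exact (searchTime_le hd).trans hs

/-! ### The online algorithm -/

section Algorithm

variable {n : ℕ}

/-- The time a robot needs to find another one. -/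
def searchWeight (x : Configuration n) (j i : Fin (n + 1)) : ℝ≥0 := searchTime (x i - x j)

/-- The time at which the algorithm tags a robot. -/
def tagTime (x : Configuration n) (i : Fin (n + 1)) : ℝ≥0 := firstPassage (searchWeight x) i

/-- The motion in which every robot, once awake, follows the search curve. -/
def searchMotion (x : Configuration n) : Motion n := fun i t => x i + search (t - tagTime x i)

lemma searchWeight_self (x : Configuration n) (i : Fin (n + 1)) : searchWeight x i i = 0 :=
  le_antisymm (searchTime_le (by simp)) zero_le

lemma tagTime_zero (x : Configuration n) : tagTime x 0 = 0 :=
  firstPassage_zero (searchWeight_self x 0)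

lemma tagTime_le_add (x : Configuration n) (j i : Fin (n + 1)) :
    tagTime x i ≤ tagTime x j + searchWeight x j i :=
  firstPassage_le_add _ j i

lemma tagTime_le_add_mul (x : Configuration n) (j i : Fin (n + 1)) :
    tagTime x i ≤
      tagTime x j + 36 * ((nndist (x j) (x i) - 1) * nndist (x j) (x i)) := by
  refine (tagTime_le_add x j i).trans ?_
  gcongr
  rw [nndist_comm, nndist_eq_nnnorm]
  exact searchTime_le_mul _

/-- By Dijkstra's principle: when the passage time of `b` is attained through an edge from `a`, the
spiral of `a` comes within range of the motionless `b` exactly at that time. -/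
lemma awake_searchMotion_of_le (x : Configuration n) (i : Fin (n + 1)) {t : ℝ≥0}
    (h : tagTime x i ≤ t) : Awake (searchMotion x) i t := by
  suffices hR : {i | Awake (searchMotion x) i (tagTime x i)} = Set.univ from
    Awake.stay h (Set.eq_univ_iff_forall.1 hR i)
  refine firstPassage_induction (w := searchWeight x) _ ?_ (searchWeight_self x 0) ?_
  · change Awake _ 0 (tagTime x 0)
    rw [tagTime_zero]; exact Awake.leader
  · intro a ha b hb
    change tagTime x b = tagTime x a + searchWeight x a b at hb
    refine Awake.tag (Awake.stay (hb ▸ le_self_add) ha) ?_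
    have := dist_search_searchTime (x b - x a)
    simp only [searchMotion, tsub_self, search_zero, add_zero]
    rw [hb, add_tsub_cancel_left]
    rw [dist_eq_norm] at this ⊢
    rwa [show x a + search (searchWeight x a b) - x b =
      search (searchTime (x b - x a)) - (x b - x a) by rw [searchWeight]; abel]

/-- A robot contacted before its passage time would still be at its starting point, so its contact
with `j` would bound the search time by `t - tagTime x j`, against the triangle inequality for
passage times. -/
lemma tagTime_le_of_awake (x : Configuration n) {i : Fin (n + 1)} {t : ℝ≥0}
    (h : Awake (searchMotion x) i t) : tagTime x i ≤ t := by
  induction h with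
  | leader => exact (tagTime_zero x).le
  | stay hst _ ih => exact ih.trans hst
  | @tag i j t _ hd ih =>
    by_contra! hlt
    refine hlt.not_ge ((tagTime_le_add x j i).trans ?_)
    rw [← le_tsub_iff_left ih]
    refine searchTime_le ?_
    simp only [searchMotion, tsub_eq_zero_of_le hlt.le, search_zero, add_zero] at hd
    rw [dist_eq_norm] at hd ⊢
    rwa [show search (t - tagTime x j) - (x i - x j) = x j + search (t - tagTime x j) - x i by
      abel]

lemma awake_searchMotion_iff (x : Configuration n) (i : Fin (n + 1)) (t : ℝ≥0) :
    Awake (searchMotion x) i t ↔ tagTime x i ≤ t :=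
  ⟨tagTime_le_of_awake x, awake_searchMotion_of_le x i⟩

lemma isAdmissible_searchMotion (x : Configuration n) : IsAdmissible x (searchMotion x) where
  start i := by simp [searchMotion]
  speed i := by
    refine LipschitzWith.of_dist_le_mul fun s t => ?_
    simp only [searchMotion, dist_add_left]
    refine (lipschitzWith_search.dist_le_mul _ _).trans ?_
    gcongr
    rw [NNReal.dist_eq, NNReal.dist_eq, NNReal.coe_sub_def, NNReal.coe_sub_def]
    exact abs_max_sub_max_le_abs _ _ _ |>.trans (by simp)
  asleep i t h := by
    rw [awake_searchMotion_iff, not_le] at h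
    simp [searchMotion, tsub_eq_zero_of_le h.le]

lemma awake_of_knows {p : Motion n} {i k : Fin (n + 1)} {t : ℝ≥0} (h : Knows p i k t) :
    Awake p i t := by
  induction h with
  | self h => exact h
  | stay hst _ ih => exact Awake.stay hst ih
  | exchange _ hd ih => exact Awake.tag ih hd

lemma view_nonempty_iff (x : Configuration n) (p : Motion n) (i : Fin (n + 1)) (t : ℝ≥0) :
    (view x p i t).Nonempty ↔ Awake p i t :=
  ⟨fun ⟨_, _, hk, _⟩ => awake_of_knows hk, fun h => ⟨_, i, Knows.self h, rfl⟩⟩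

/-- The algorithm in which every robot, once awake, follows the search curve. -/
def searchAlgorithm : OnlineAlgorithm where
  run x := searchMotion x
  admissible x := isAdmissible_searchMotion x
  online {n m} x y i j t h := by
    -- A view is nonempty exactly when the robot is awake, so equal histories give tag times that
    -- agree as far as they can be seen by time `t`.
    have key : ∀ s ≤ t, tagTime x i ≤ s ↔ tagTime y j ≤ s := fun s hs => by
      rw [← awake_searchMotion_iff, ← awake_searchMotion_iff, ← view_nonempty_iff x,
        ← view_nonempty_iff y, h s hs]
    have e : t - tagTime x i = t - tagTime y j := by
      rcases le_or_gt (tagTime x i) t with h1 | h1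
      · have h2 := (key t le_rfl).1 h1
        rw [le_antisymm ((key _ h2).2 le_rfl) ((key _ h1).1 le_rfl)]
      · have h2 : t < tagTime y j := not_le.1 fun h2 => h1.not_ge ((key t le_rfl).2 h2)
        rw [tsub_eq_zero_of_le h1.le, tsub_eq_zero_of_le h2.le]
    simp [searchMotion, e]

lemma cost_searchAlgorithm_le (x : Configuration n) {t : ℝ≥0} (h : ∀ i, tagTime x i ≤ t) :
    searchAlgorithm.cost x ≤ t :=
  iSup_le fun i => iInf₂_le t (awake_searchMotion_of_le x i (h i))

end Algorithm

/-! ### Lower bound on the offline optimum -/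

section Offline

variable {n : ℕ}

/-- The time a robot needs to tag another one whose position it knows. -/
def gap (x : Configuration n) (j i : Fin (n + 1)) : ℝ≥0 := nndist (x j) (x i) - 1

/-- The first-passage time of the offline problem. -/
def gapTime (x : Configuration n) (i : Fin (n + 1)) : ℝ≥0 := firstPassage (gap x) i

/-- The largest first-passage time of the offline problem. -/
def maxGapTime (x : Configuration n) : ℝ≥0 := ⨆ i, gapTime x i

lemma gap_self (x : Configuration n) (i : Fin (n + 1)) : gap x i i = 0 := by simp [gap]

lemma gapTime_zero (x : Configuration n) : gapTime x 0 = 0 := firstPassage_zero (gap_self x 0)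

lemma gapTime_le_maxGapTime (x : Configuration n) (i : Fin (n + 1)) :
    gapTime x i ≤ maxGapTime x :=
  le_ciSup (Set.finite_range _).bddAbove i

lemma dist_le_of_asleep {x : Configuration n} {p : Motion n} (hp : IsAdmissible x p)
    {i : Fin (n + 1)} {s : ℝ≥0} (h : ∀ r < s, ¬ Awake p i r) (t : ℝ≥0) :
    dist (p i t) (x i) ≤ ((t - s : ℝ≥0) : ℝ) := by
  rcases lt_or_ge t s with hts | hst
  · rw [hp.asleep i t (h t hts), dist_self]; positivity
  have hs : p i s = x i := by
    rcases eq_or_ne s 0 with rfl | h0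
    · exact hp.start i
    have hcl : IsClosed {r | p i r = x i} :=
      isClosed_eq (hp.speed i).continuous continuous_const
    have : s ∈ closure (Set.Iio s) := by
      rw [closure_Iio' ⟨0, pos_iff_ne_zero.2 h0⟩]; exact Set.self_mem_Iic
    exact hcl.closure_subset_iff.2 (fun r hr => hp.asleep i r (h r hr)) this
  rw [← hs]
  refine ((hp.speed i).dist_le_mul t s).trans ?_
  rw [NNReal.coe_one, one_mul, NNReal.dist_eq, NNReal.coe_sub hst,
    abs_of_nonneg (sub_nonneg.2 (NNReal.coe_le_coe.2 hst))]

/-- Let `T` be the infimum of the times at which some robot is awake too early. It need not be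
attained, and tags may chain at a single instant, so the argument runs on `[0, T + δ)`, with `3 δ`
no more than the distance from `T` to the next passage time. There `j` has strayed at most `t -
gapTime x j` and `i` at most `t - T`, so a contact gives `gapTime x i ≤ T + 2 δ`, which is
impossible if it exceeds `T`. -/
lemma gapTime_le_of_awake {x : Configuration n} {p : Motion n} (hp : IsAdmissible x p)
    {i : Fin (n + 1)} {t : ℝ≥0} (h : Awake p i t) : gapTime x i ≤ t := by
  by_contra! hlt
  set B : Set ℝ≥0 := {t | ∃ i, Awake p i t ∧ t < gapTime x i} with hB
  have hBne : B.Nonempty := ⟨t, i, h, hlt⟩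
  set T := sInf B with hT
  have hbefore : ∀ r < T, ∀ i, Awake p i r → gapTime x i ≤ r := fun r hr i hi => by
    by_contra! hc
    exact hr.not_ge (csInf_le (OrderBot.bddBelow _) ⟨i, hi, hc⟩)
  obtain ⟨δ, hδ0, hδ⟩ : ∃ δ : ℝ≥0, 0 < δ ∧ ∀ i, T < gapTime x i → T + 3 * δ ≤ gapTime x i := by
    classical
    rcases (Finset.univ.filter fun i => T < gapTime x i).eq_empty_or_nonempty with he | hne
    · exact ⟨1, one_pos, fun i hi => absurd (Finset.mem_filter.2 ⟨Finset.mem_univ i, hi⟩)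
        (by rw [he]; simp)⟩
    · obtain ⟨k, hk, hmin⟩ := Finset.exists_min_image _ (gapTime x) hne
      simp only [Finset.mem_filter, Finset.mem_univ, true_and] at hk hmin
      refine ⟨(gapTime x k - T) / 3, div_pos (tsub_pos_of_lt hk) (by norm_num), fun i hi => ?_⟩
      rw [mul_div_cancel₀ _ (by norm_num), add_tsub_cancel_of_le hk.le]
      exact hmin i hi
  have hasleep : ∀ k, ∀ r < min (gapTime x k) T, ¬ Awake p k r := fun k r hr hk =>
    (lt_min_iff.1 hr).1.not_ge (hbefore r (lt_min_iff.1 hr).2 k hk)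
  have key : ∀ {i : Fin (n + 1)} {t : ℝ≥0}, Awake p i t → t < T + δ → gapTime x i ≤ T := by
    intro i t h
    induction h with
    | leader => intro _; rw [gapTime_zero]; exact zero_le
    | stay hst _ ih => exact fun ht => ih (hst.trans_lt ht)
    | @tag i j t hj hd ih =>
      intro ht
      by_contra! hi
      have hjT := ih ht
      have dj := dist_le_of_asleep hp (hasleep j) t
      have di := dist_le_of_asleep hp (hasleep i) t
      rw [min_eq_left hjT] at dj
      rw [min_eq_right hi.le] at di
      have hji := (firstPassage_le_add (gap x) j i)
      change gapTime x i ≤ gapTime x j + gap x j i at hji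
      have h3 := hδ i hi
      have tri : dist (x j) (x i) ≤
          ((t - gapTime x j : ℝ≥0) : ℝ) + 1 + ((t - T : ℝ≥0) : ℝ) := by
        have := dist_triangle4 (x j) (p j t) (p i t) (x i)
        rw [dist_comm (x j) (p j t)] at this
        linarith
      have hgap : gap x j i ≤ (t - gapTime x j) + (t - T) := by
        rw [gap, tsub_le_iff_right, ← NNReal.coe_le_coe]
        push_cast
        linarith
      have h5 : t - T ≤ δ := tsub_le_iff_left.2 ht.le
      have h6 : gapTime x j + (t - gapTime x j) ≤ T + δ := by
        rw [add_tsub_eq_max]; exact max_le (hjT.trans le_self_add) ht.le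
      have h7 : gapTime x i ≤ T + 2 * δ :=
        calc gapTime x i ≤ gapTime x j + ((t - gapTime x j) + (t - T)) := by
              exact hji.trans (by gcongr)
          _ = gapTime x j + (t - gapTime x j) + (t - T) := (add_assoc _ _ _).symm
          _ ≤ T + δ + δ := add_le_add h6 h5
          _ = T + 2 * δ := by ring
      have h8 := h3.trans h7
      have : (3 : ℝ≥0) * δ ≤ 2 * δ := le_of_add_le_add_left h8
      exact absurd (le_of_mul_le_mul_right this hδ0) (by norm_num)
  obtain ⟨t', ⟨i', hi', hlt'⟩, ht'⟩ := exists_lt_of_csInf_lt hBne (lt_add_of_pos_right T hδ0)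
  have hTt : T ≤ t' := csInf_le (OrderBot.bddBelow _) ⟨i', hi', hlt'⟩
  exact hlt'.not_ge ((key hi' ht').trans hTt)

lemma maxGapTime_le_opt (x : Configuration n) : (maxGapTime x : ℝ≥0∞) ≤ opt x := by
  refine le_iInf₂ fun p hp => ?_
  obtain ⟨i, hi⟩ := exists_eq_ciSup_of_finite (f := gapTime x)
  rw [maxGapTime, ← hi]
  refine le_trans ?_ (le_iSup (wakeTime p) i)
  exact le_iInf₂ fun t ht => ENNReal.coe_le_coe.2 (gapTime_le_of_awake hp ht)

end Offline

/-! ### The largest gap between complementary groups of robots -/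

section Cut

variable {n : ℕ}

/-- The distance between a set of robots and its complement (`0` if one of them is empty). -/
def cutGap (x : Configuration n) (U : Set (Fin (n + 1))) : ℝ≥0 :=
  ⨅ p : {p : Fin (n + 1) × Fin (n + 1) // p.1 ∈ U ∧ p.2 ∉ U}, nndist (x p.1.1) (x p.1.2)

/-- The largest distance between complementary sets of robots. -/
def cutValue (x : Configuration n) : ℝ≥0 := ⨆ U : Set (Fin (n + 1)), cutGap x U

lemma cutGap_le (x : Configuration n) {U : Set (Fin (n + 1))} {a c : Fin (n + 1)} (ha : a ∈ U)
    (hc : c ∉ U) : cutGap x U ≤ nndist (x a) (x c) :=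
  ciInf_le (OrderBot.bddBelow _) (⟨(a, c), ha, hc⟩ :
    {p : Fin (n + 1) × Fin (n + 1) // p.1 ∈ U ∧ p.2 ∉ U})

lemma cutGap_le_cutValue (x : Configuration n) (U : Set (Fin (n + 1))) :
    cutGap x U ≤ cutValue x :=
  le_ciSup (Set.finite_range _).bddAbove U

lemma exists_crossing (x : Configuration n) {U : Set (Fin (n + 1))} (hU : U.Nonempty)
    (hU' : U ≠ Set.univ) : ∃ a ∈ U, ∃ c ∉ U, nndist (x a) (x c) ≤ cutValue x := by
  obtain ⟨a, ha⟩ := hU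
  obtain ⟨c, hc⟩ := (Set.ne_univ_iff_exists_notMem _).1 hU'
  have : Nonempty {p : Fin (n + 1) × Fin (n + 1) // p.1 ∈ U ∧ p.2 ∉ U} := ⟨⟨(a, c), ha, hc⟩⟩
  obtain ⟨⟨⟨a', c'⟩, ha', hc'⟩, h⟩ := exists_eq_ciInf_of_finite
    (f := fun p : {p : Fin (n + 1) × Fin (n + 1) // p.1 ∈ U ∧ p.2 ∉ U} =>
      nndist (x p.1.1) (x p.1.2))
  exact ⟨a', ha', c', hc', h.le.trans (cutGap_le_cutValue x U)⟩

lemma le_cutValue {x : Configuration n} {U : Set (Fin (n + 1))} {r : ℝ≥0} (hU : U.Nonempty)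
    (hU' : U ≠ Set.univ) (h : ∀ a ∈ U, ∀ c ∉ U, r ≤ nndist (x a) (x c)) : r ≤ cutValue x := by
  obtain ⟨a, ha⟩ := hU
  obtain ⟨c, hc⟩ := (Set.ne_univ_iff_exists_notMem _).1 hU'
  have : Nonempty {p : Fin (n + 1) × Fin (n + 1) // p.1 ∈ U ∧ p.2 ∉ U} := ⟨⟨(a, c), ha, hc⟩⟩
  refine le_trans (le_ciInf ?_) (cutGap_le_cutValue x U)
  rintro ⟨⟨a', c'⟩, ha', hc'⟩
  exact h a' ha' c' hc'

lemma cutValue_le_of_forall {x : Configuration n} {r : ℝ≥0}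
    (h : ∀ U : Set (Fin (n + 1)), U.Nonempty → U ≠ Set.univ → cutGap x U ≤ r) :
    cutValue x ≤ r := by
  refine ciSup_le fun U => ?_
  by_cases hU : U.Nonempty ∧ U ≠ Set.univ
  · exact h U hU.1 hU.2
  -- For a trivial cut the infimum is over an empty type, and in `ℝ≥0` it is `0`.
  · have : IsEmpty {p : Fin (n + 1) × Fin (n + 1) // p.1 ∈ U ∧ p.2 ∉ U} :=
      ⟨fun p => hU ⟨⟨_, p.2.1⟩, (Set.ne_univ_iff_exists_notMem _).2 ⟨_, p.2.2⟩⟩⟩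
    rw [cutGap, iInf_of_isEmpty, NNReal.sInf_empty]
    exact zero_le

/-- A path in the tree between the two sides of a cut must use a crossing edge. -/
lemma cutValue_le_longestEdge (x : Configuration n) : (cutValue x : ℝ≥0∞) ≤ longestEdge x := by
  refine le_iInf₂ fun T hT => ?_
  have : cutValue x ≤ (⨆ e ∈ T.edgeSet, (edgeLength x e : ℝ≥0∞)).toNNReal ∨
      (⨆ e ∈ T.edgeSet, (edgeLength x e : ℝ≥0∞)) = ⊤ := by
    by_cases htop : (⨆ e ∈ T.edgeSet, (edgeLength x e : ℝ≥0∞)) = ⊤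
    · exact Or.inr htop
    refine Or.inl (cutValue_le_of_forall fun U hU hU' => ?_)
    obtain ⟨a, ha⟩ := hU
    obtain ⟨c, hc⟩ := (Set.ne_univ_iff_exists_notMem _).1 hU'
    obtain ⟨w⟩ := hT.1.connected.preconnected a c
    obtain ⟨d, -, hd1, hd2⟩ := w.exists_boundary_dart U ha hc
    refine (cutGap_le x hd1 hd2).trans ?_
    rw [← ENNReal.coe_le_coe, ENNReal.coe_toNNReal htop]
    exact le_iSup₂_of_le s(d.fst, d.snd) d.adj le_rfl
  rcases this with h | h
  · exact (ENNReal.coe_le_coe.2 h).trans ENNReal.coe_toNNReal_le_self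
  · rw [h]; exact le_top

/-- The function that is `0` on the leader's side of a cut and `cutGap x U - 1` on the other side is
a potential for `gap`. -/
lemma cutValue_sub_one_le_maxGapTime (x : Configuration n) :
    cutValue x - 1 ≤ maxGapTime x := by
  classical
  rw [tsub_le_iff_right]
  refine cutValue_le_of_forall fun U hU hU' => ?_
  rw [← tsub_le_iff_right]
  have key : ∀ i, (if (i ∈ U ↔ (0 : Fin (n + 1)) ∈ U) then 0 else cutGap x U - 1) ≤
      gapTime x i := by
    refine le_firstPassage (by simp) fun a b => ?_
    by_cases ha : a ∈ U <;> by_cases hb : b ∈ U <;> by_cases h0 : (0 : Fin (n + 1)) ∈ U <;>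
      simp only [ha, hb, h0, iff_true, iff_false, not_true_eq_false,
        if_true, if_false, zero_add, zero_le, le_add_iff_nonneg_right]
    · exact tsub_le_tsub_right (cutGap_le x ha hb) 1
    · rw [gap, nndist_comm]; exact tsub_le_tsub_right (cutGap_le x hb ha) 1
  obtain ⟨a, ha⟩ := hU
  obtain ⟨c, hc⟩ := (Set.ne_univ_iff_exists_notMem _).1 hU'
  by_cases h0 : (0 : Fin (n + 1)) ∈ U
  · have := key c
    simp only [hc, h0, iff_true, if_false] at this
    exact this.trans (gapTime_le_maxGapTime x c)
  · have := key a
    simp only [ha, h0, iff_false, not_true_eq_false, if_false] at this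
    exact this.trans (gapTime_le_maxGapTime x a)

lemma measurable_cutValue : Measurable (cutValue (n := n)) :=
  Measurable.iSup fun _ => Measurable.iInf fun p =>
    (measurable_pi_apply p.1.1).nndist (measurable_pi_apply p.1.2)

lemma measurable_pathCost_gap (l : List (Fin (n + 1))) (a b : Fin (n + 1)) :
    Measurable fun x : Configuration n => pathCost (gap x) a l b := by
  induction l generalizing a with
  | nil => exact ((measurable_pi_apply a).nndist (measurable_pi_apply b)).sub_const 1
  | cons c l ih =>
    exact (((measurable_pi_apply a).nndist (measurable_pi_apply c)).sub_const 1).add (ih c)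

lemma measurable_maxGapTime : Measurable (maxGapTime (n := n)) :=
  Measurable.iSup fun i => Measurable.iInf fun l => measurable_pathCost_gap l 0 i

/-- The lower bound on the product of the longest edge and the offline optimum that the cost of the
algorithm is compared with. -/
def benchmark (x : Configuration n) : ℝ≥0 := cutValue x * maxGapTime x

lemma measurable_benchmark : Measurable (benchmark (n := n)) :=
  measurable_cutValue.mul measurable_maxGapTime

lemma benchmark_le (x : Configuration n) :
    (benchmark x : ℝ≥0∞) ≤ longestEdge x * opt x := by
  rw [benchmark, ENNReal.coe_mul]
  exact mul_le_mul' (cutValue_le_longestEdge x) (maxGapTime_le_opt x)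

lemma cutValue_mul_le_benchmark (x : Configuration n) :
    (cutValue x - 1) * cutValue x ≤ benchmark x := by
  rw [benchmark, mul_comm]
  exact mul_le_mul' le_rfl (cutValue_sub_one_le_maxGapTime x)

/-- Every period of length `Δ` tags a new robot until none is left: some pair across the cut between
tagged and untagged robots is at distance at most `cutValue x`. Since the leader starts awake, `n`
periods are enough. -/
lemma tagTime_le_cutValue (x : Configuration n) (i : Fin (n + 1)) :
    tagTime x i ≤ n * (36 * ((cutValue x - 1) * cutValue x)) := by
  classical
  set Δ := 36 * ((cutValue x - 1) * cutValue x) with hΔ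
  have key : ∀ k : ℕ, (∀ i, tagTime x i ≤ k * Δ) ∨
      k + 1 ≤ (Finset.univ.filter fun i => tagTime x i ≤ k * Δ).card := by
    intro k
    induction k with
    | zero =>
      refine Or.inr (Finset.card_pos.2 ⟨0, ?_⟩)
      simp [tagTime_zero]
    | succ k ih =>
      have hmono : (k : ℝ≥0) * Δ ≤ ((k + 1 : ℕ) : ℝ≥0) * Δ := by gcongr; simp
      rcases ih with h | h
      · exact Or.inl fun i => (h i).trans hmono
      by_cases hall : ∀ i, tagTime x i ≤ k * Δ
      · exact Or.inl fun i => (hall i).trans hmono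
      right
      push Not at hall
      obtain ⟨b, hb⟩ := hall
      obtain ⟨a, ha, c, hc, hac⟩ := exists_crossing x (U := {i | tagTime x i ≤ k * Δ})
        ⟨0, by simp [tagTime_zero]⟩
        ((Set.ne_univ_iff_exists_notMem _).2 ⟨b, by simpa using hb⟩)
      refine Nat.succ_le_of_lt (h.trans_lt (Finset.card_lt_card ?_))
      refine Finset.ssubset_iff_of_subset (fun i hi => ?_) |>.2 ⟨c, ?_, ?_⟩
      · simp only [Finset.mem_filter, Finset.mem_univ, true_and] at hi ⊢
        exact hi.trans hmono
      · simp only [Finset.mem_filter, Finset.mem_univ, true_and]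
        have ha' : tagTime x a ≤ k * Δ := ha
        calc tagTime x c ≤ tagTime x a +
              36 * ((nndist (x a) (x c) - 1) * nndist (x a) (x c)) := tagTime_le_add_mul x a c
          _ ≤ k * Δ + Δ := by rw [hΔ] at ha' ⊢; gcongr
          _ = ((k + 1 : ℕ) : ℝ≥0) * Δ := by push_cast; ring
      · simpa using hc
  rcases key n with h | h
  · exact h i
  · have : (Finset.univ.filter fun i => tagTime x i ≤ n * Δ) = Finset.univ :=
      Finset.eq_univ_of_card _ (le_antisymm (Finset.card_le_univ _) (by simpa using h))
    have hi : i ∈ Finset.univ.filter fun i => tagTime x i ≤ n * Δ := by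
      rw [this]; exact Finset.mem_univ i
    simpa using hi

/-- This worst-case bound is what is paid on rare bad deployments and for boundedly many robots. -/
lemma tagTime_le_benchmark (x : Configuration n) (i : Fin (n + 1)) :
    tagTime x i ≤ 36 * n * benchmark x := by
  refine (tagTime_le_cutValue x i).trans ?_
  calc (n : ℝ≥0) * (36 * ((cutValue x - 1) * cutValue x))
      ≤ n * (36 * benchmark x) := by gcongr; exact cutValue_mul_le_benchmark x
    _ = 36 * n * benchmark x := by ring

lemma tagTime_eq_zero {x : Configuration n} (h : cutValue x ≤ 1) (i : Fin (n + 1)) :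
    tagTime x i = 0 := by
  have := tagTime_le_cutValue x i
  rw [tsub_eq_zero_of_le h] at this
  simpa using this

end Cut

/-! ### Configurations without long detours -/

section Stretch

variable {n : ℕ}

/-- Between any two robots further than `5 R` apart there is a robot reachable by a hop of length at
most `5 R` that is closer to the target by `R`. -/
def HasHops (x : Configuration n) (R : ℝ≥0) : Prop :=
  ∀ j i, 5 * R < nndist (x j) (x i) →
    ∃ r, nndist (x j) (x r) ≤ 5 * R ∧ nndist (x r) (x i) + R ≤ nndist (x j) (x i)

/-- Each hop costs at most `36 (5 R) ^ 2` and lowers the remaining distance by `R`; one more short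
search finishes the journey. -/
lemma HasHops.tagTime_le_of_le_mul {x : Configuration n} {R : ℝ≥0} (h : HasHops x R) (k : ℕ)
    (j i : Fin (n + 1)) (hk : nndist (x j) (x i) ≤ k * R) :
    tagTime x i ≤ tagTime x j + (k + 1) * (36 * (5 * R) ^ 2) := by
  have short : ∀ a b, nndist (x a) (x b) ≤ 5 * R →
      tagTime x b ≤ tagTime x a + 36 * (5 * R) ^ 2 := fun a b hab => by
    refine (tagTime_le_add_mul x a b).trans ?_
    rw [sq]
    gcongr
    exact tsub_le_self.trans hab
  induction k generalizing j with
  | zero =>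
    have := short j i (hk.trans (by rw [Nat.cast_zero, zero_mul]; exact zero_le))
    simpa using this
  | succ k ih =>
    rcases le_or_gt (nndist (x j) (x i)) (5 * R) with hle | hlt
    · refine (short j i hle).trans ?_
      have h1 : (1 : ℝ≥0) ≤ ((k + 1 : ℕ) : ℝ≥0) + 1 := le_add_of_nonneg_left zero_le
      gcongr tagTime x j + ?_
      exact le_mul_of_one_le_left zero_le h1
    · obtain ⟨r, h1, h2⟩ := h j i hlt
      have h3 : nndist (x r) (x i) ≤ k * R := by
        have := h2.trans hk
        push_cast at this
        rw [add_mul, one_mul] at this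
        exact le_of_add_le_add_right this
      calc tagTime x i ≤ tagTime x r + (k + 1) * (36 * (5 * R) ^ 2) := ih r h3
        _ ≤ tagTime x j + 36 * (5 * R) ^ 2 + (k + 1) * (36 * (5 * R) ^ 2) := by
          gcongr; exact short j r h1
        _ = tagTime x j + ((k + 1 : ℕ) + 1) * (36 * (5 * R) ^ 2) := by push_cast; ring

/-- On an edge of length at most `5 R`, the search bound `36 (d - 1) d` is already linear in the
gap. A longer edge is replaced by about `d / R` hops of cost `O(R ^ 2)`, and there `d ≤ 5 / 4 (d -
1)` since `d ≥ 5`. -/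
lemma HasHops.tagTime_le_add_gap {x : Configuration n} {R : ℝ≥0} (hR : 1 ≤ R) (h : HasHops x R)
    (j i : Fin (n + 1)) : tagTime x i ≤ tagTime x j + 2000 * R * gap x j i := by
  rcases le_or_gt (nndist (x j) (x i)) (5 * R) with hle | hlt
  · refine (tagTime_le_add_mul x j i).trans ?_
    gcongr tagTime x j + ?_
    calc 36 * ((nndist (x j) (x i) - 1) * nndist (x j) (x i)) = 36 * (gap x j i *
          nndist (x j) (x i)) := rfl
      _ ≤ 36 * (gap x j i * (5 * R)) := by gcongr
      _ = 180 * R * gap x j i := by ring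
      _ ≤ 2000 * R * gap x j i := by gcongr; norm_num
  · have hR0 : (0 : ℝ≥0) < R := one_pos.trans_le hR
    set ℓ := nndist (x j) (x i) with hℓ
    have hk1 : ℓ ≤ (⌈ℓ / R⌉₊ : ℕ) * R := by
      rw [← div_le_iff₀ hR0]; exact Nat.le_ceil _
    have hk2 : ((⌈ℓ / R⌉₊ : ℕ) : ℝ≥0) ≤ ℓ / R + 1 := (Nat.ceil_lt_add_one zero_le).le
    refine (h.tagTime_le_of_le_mul _ j i hk1).trans ?_
    gcongr tagTime x j + ?_
    have hgap : ℓ ≤ gap x j i * (5 / 4) := by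
      have h5 : 5 ≤ ℓ := by
        have : (5 : ℝ≥0) * 1 ≤ 5 * R := by gcongr
        exact (by simpa using this : (5 : ℝ≥0) ≤ 5 * R).trans hlt.le
      have h1 : (1 : ℝ≥0) ≤ ℓ := le_trans (by norm_num) h5
      rw [gap, ← hℓ, ← NNReal.coe_le_coe]
      rw [← NNReal.coe_le_coe] at h5
      push_cast [NNReal.coe_sub h1] at h5 ⊢
      linarith
    calc ((⌈ℓ / R⌉₊ : ℕ) + 1) * (36 * (5 * R) ^ 2) ≤ (ℓ / R + 1 + 1) * (36 * (5 * R) ^ 2) := by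
          gcongr
      _ = 900 * R * (ℓ + 2 * R) := by field_simp; ring
      _ ≤ 900 * R * (ℓ + 2 / 5 * ℓ) := by
          gcongr 900 * R * (ℓ + ?_)
          calc 2 * R = 2 / 5 * (5 * R) := by field_simp
            _ ≤ 2 / 5 * ℓ := by gcongr
      _ = 1260 * R * ℓ := by ring
      _ ≤ 1260 * R * (gap x j i * (5 / 4)) := by gcongr
      _ = 1575 * R * gap x j i := by ring
      _ ≤ 2000 * R * gap x j i := by gcongr; norm_num

lemma HasHops.tagTime_le {x : Configuration n} {R : ℝ≥0} (hR : 1 ≤ R) (h : HasHops x R)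
    (i : Fin (n + 1)) : tagTime x i ≤ 2000 * R * maxGapTime x := by
  have hc : 0 < 2000 * R := mul_pos (by norm_num) (one_pos.trans_le hR)
  have := le_firstPassage (w := gap x) (f := fun i => tagTime x i / (2000 * R))
    (by simp [tagTime_zero]) (fun a b => ?_) i
  · rw [mul_comm, ← div_le_iff₀ hc]
    exact this.trans (gapTime_le_maxGapTime x i)
  · rw [div_add' _ _ _ hc.ne']
    gcongr
    rw [mul_comm (gap x a b)]
    exact h.tagTime_le_add_gap hR a b

/-- If the hops are at most a constant times the largest gap, the cost is at most a constant times
the benchmark. -/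
lemma HasHops.tagTime_le_benchmark {x : Configuration n} {R K : ℝ≥0} (hR : 1 ≤ R)
    (h : HasHops x R) (hK : 1 < cutValue x → R ≤ K * cutValue x) (i : Fin (n + 1)) :
    tagTime x i ≤ 2000 * K * benchmark x := by
  rcases le_or_gt (cutValue x) 1 with hle | hlt
  · rw [tagTime_eq_zero hle]; exact zero_le
  · calc tagTime x i ≤ 2000 * R * maxGapTime x := h.tagTime_le hR i
      _ ≤ 2000 * (K * cutValue x) * maxGapTime x := by gcongr; exact hK hlt
      _ = 2000 * K * benchmark x := by rw [benchmark]; ring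

end Stretch

/-! ### Occupancy estimates for independent points -/

section Occupancy

variable {X : Type*} [MeasurableSpace X] {ι : Type*} [Fintype ι]

lemma measureReal_pi_box (P : Measure X) [IsProbabilityMeasure P] (D : ι → Set X) :
    (Measure.pi fun _ : ι => P).real {x | ∀ i, x i ∈ D i} = ∏ i, P.real (D i) := by
  have : {x : ι → X | ∀ i, x i ∈ D i} = Set.univ.pi D := by ext; simp
  rw [this, Measure.real, Measure.pi_pi, ENNReal.toReal_prod]
  rfl

/-- The probability that `z` of the disjoint sets `E q`, `q ∈ Q`, are missed by all points. -/
lemma measureReal_void_le (P : Measure X) [IsProbabilityMeasure P] {J : Type*} (Q : Finset J)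
    {E : J → Set X} (hE : ∀ q, MeasurableSet (E q)) (hdisj : Pairwise (Function.onFun Disjoint E))
    {p : ℝ} (hp : ∀ q ∈ Q, P.real (E q) = p) (z : ℕ) :
    (Measure.pi fun _ : ι => P).real
        {x | ∃ S ⊆ Q, S.card = z ∧ ∀ q ∈ S, ∀ i, x i ∉ E q} ≤
      (Q.card * Real.exp (-(p * Fintype.card ι))) ^ z := by
  have hsub : {x : ι → X | ∃ S ⊆ Q, S.card = z ∧ ∀ q ∈ S, ∀ i, x i ∉ E q} =
      ⋃ S ∈ Q.powersetCard z, {x : ι → X | ∀ i, x i ∈ (⋃ q ∈ S, E q)ᶜ} := by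
    ext x
    simp only [Set.mem_ofPred_eq, Set.mem_iUnion, Finset.mem_powersetCard, Set.mem_compl_iff,
      exists_prop, not_exists, not_and]
    exact ⟨fun ⟨S, h1, h2, h3⟩ => ⟨S, ⟨h1, h2⟩, fun i q hq => h3 q hq i⟩,
      fun ⟨S, ⟨h1, h2⟩, h3⟩ => ⟨S, h1, h2, fun q hq i => h3 i q hq⟩⟩
  have hone : ∀ S ∈ Q.powersetCard z, (Measure.pi fun _ : ι => P).real
      {x : ι → X | ∀ i, x i ∈ (⋃ q ∈ S, E q)ᶜ} ≤ Real.exp (-(p * Fintype.card ι)) ^ z := by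
    intro S hS
    obtain ⟨hSQ, hSz⟩ := Finset.mem_powersetCard.1 hS
    have hm : MeasurableSet (⋃ q ∈ S, E q) := S.measurableSet_biUnion fun q _ => hE q
    have hU : P.real (⋃ q ∈ S, E q) = z * p := by
      rw [measureReal_biUnion_finset (fun a _ b _ hab => hdisj hab) (fun q _ => hE q),
        Finset.sum_congr rfl fun q hq => hp q (hSQ hq), Finset.sum_const, hSz, nsmul_eq_mul]
    rw [measureReal_pi_box, Finset.prod_const, Finset.card_univ, probReal_compl_eq_one_sub hm, hU]
    calc (1 - z * p) ^ Fintype.card ι ≤ Real.exp (-(z * p)) ^ Fintype.card ι := by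
          refine pow_le_pow_left₀ ?_ (by linarith [Real.add_one_le_exp (-(z * p))]) _
          rw [← hU]; linarith [measureReal_le_one (μ := P) (s := ⋃ q ∈ S, E q)]
      _ = Real.exp (-(p * Fintype.card ι)) ^ z := by
          rw [← Real.exp_nat_mul, ← Real.exp_nat_mul]; ring_nf
  rw [hsub]
  calc _ ≤ ∑ S ∈ Q.powersetCard z, (Measure.pi fun _ : ι => P).real
        {x : ι → X | ∀ i, x i ∈ (⋃ q ∈ S, E q)ᶜ} := measureReal_biUnion_finset_le _ _
    _ ≤ ∑ S ∈ Q.powersetCard z, Real.exp (-(p * Fintype.card ι)) ^ z := Finset.sum_le_sum hone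
    _ = (Q.card.choose z : ℝ) * Real.exp (-(p * Fintype.card ι)) ^ z := by
        rw [Finset.sum_const, Finset.card_powersetCard, nsmul_eq_mul]
    _ ≤ (Q.card : ℝ) ^ z * Real.exp (-(p * Fintype.card ι)) ^ z := by
        gcongr; exact_mod_cast Nat.choose_le_pow _ _
    _ = _ := (mul_pow _ _ _).symm

/-- The probability, given the cells `a i` of the points, that in each cell of `F` there is a point
outside the core. -/
lemma measureReal_allocated (P : Measure X) [IsProbabilityMeasure P] {J : Type*} [DecidableEq J]
    {idx : X → J} {core : Set X} (hcore : MeasurableSet core) {β : ℝ}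
    (a : ι → J) (F : Finset J)
    (hF : ∀ q ∈ F, P.real (idx ⁻¹' {q} ∩ core) = β * P.real (idx ⁻¹' {q}))
    (D : ι → Set X) (hD : ∀ i, MeasurableSet (D i)) (hDF : ∀ i, a i ∈ F → D i = idx ⁻¹' {a i}) :
    (Measure.pi fun _ : ι => P).real
        {x | (∀ i, x i ∈ D i) ∧ ∀ q ∈ F, ∃ i, a i = q ∧ x i ∉ core} =
      (∏ i, P.real (D i)) * ∏ q ∈ F, (1 - β ^ (Finset.univ.filter fun i => a i = q).card) := by
  induction F using Finset.induction_on generalizing D with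
  | empty => simpa using measureReal_pi_box P D
  | insert q F hq ih =>
    -- Some point of cell `q` is outside the core exactly when the points allocated to `q` are not
    -- all confined to it. The event is thus a difference of two events for `F`, the second with
    -- shrunken boxes `D'`; this is why the induction is over arbitrary `D`.
    let D' : ι → Set X := fun i => if a i = q then D i ∩ core else D i
    have hD' : ∀ i, MeasurableSet (D' i) := fun i => by
      simp only [D']; split_ifs
      · exact (hD i).inter hcore
      · exact hD i
    have hD'F : ∀ i, a i ∈ F → D' i = idx ⁻¹' {a i} := fun i hi => by
      have : a i ≠ q := fun h => hq (h ▸ hi)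
      simp only [D', this, if_false]
      exact hDF i (Finset.mem_insert_of_mem hi)
    have hF' := fun r hr => hF r (Finset.mem_insert_of_mem hr)
    have ih1 := ih hF' D hD fun i hi => hDF i (Finset.mem_insert_of_mem hi)
    have ih2 := ih hF' D' hD' hD'F
    have hset : {x : ι → X | (∀ i, x i ∈ D i) ∧ ∀ r ∈ insert q F, ∃ i, a i = r ∧ x i ∉ core} =
        {x | (∀ i, x i ∈ D i) ∧ ∀ r ∈ F, ∃ i, a i = r ∧ x i ∉ core} \
          {x | (∀ i, x i ∈ D' i) ∧ ∀ r ∈ F, ∃ i, a i = r ∧ x i ∉ core} := by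
      ext x
      simp only [Finset.forall_mem_insert, Set.mem_ofPred_eq, Set.mem_sdiff, not_and]
      constructor
      · rintro ⟨h1, ⟨i, hi, hx⟩, h3⟩
        refine ⟨⟨h1, h3⟩, fun h => absurd (h i) ?_⟩
        simp [D', hi, hx]
      · rintro ⟨⟨h1, h3⟩, h⟩
        refine ⟨h1, ?_, h3⟩
        by_contra! hc
        refine h (fun i => ?_) h3
        by_cases hi : a i = q
        · simp only [D', hi, if_true]; exact ⟨h1 i, hc i hi⟩
        · simp only [D', hi, if_false]; exact h1 i
    have hmeas : ∀ D : ι → Set X, (∀ i, MeasurableSet (D i)) →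
        MeasurableSet {x : ι → X | (∀ i, x i ∈ D i) ∧ ∀ r ∈ F, ∃ i, a i = r ∧ x i ∉ core} := by
      intro D hD
      have e : {x : ι → X | (∀ i, x i ∈ D i) ∧ ∀ r ∈ F, ∃ i, a i = r ∧ x i ∉ core} =
          (⋂ i, (fun x => x i) ⁻¹' D i) ∩
            ⋂ r ∈ F, ⋃ i, ⋃ _ : a i = r, (fun x => x i) ⁻¹' coreᶜ := by
        ext x; simp
      rw [e]
      refine (MeasurableSet.iInter fun i => measurable_pi_apply i (hD i)).inter ?_
      exact F.measurableSet_biInter fun r _ => MeasurableSet.iUnion fun i =>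
        MeasurableSet.iUnion fun _ => measurable_pi_apply i hcore.compl
    have hsub : {x : ι → X | (∀ i, x i ∈ D' i) ∧ ∀ r ∈ F, ∃ i, a i = r ∧ x i ∉ core} ⊆
        {x | (∀ i, x i ∈ D i) ∧ ∀ r ∈ F, ∃ i, a i = r ∧ x i ∉ core} := by
      rintro x ⟨h1, h2⟩
      refine ⟨fun i => ?_, h2⟩
      have := h1 i
      simp only [D'] at this
      split_ifs at this
      · exact this.1
      · exact this
    have hprod : ∏ i, P.real (D' i) =
        β ^ (Finset.univ.filter fun i => a i = q).card * ∏ i, P.real (D i) := by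
      rw [← Finset.prod_const, Finset.prod_filter, ← Finset.prod_mul_distrib]
      refine Finset.prod_congr rfl fun i _ => ?_
      by_cases hi : a i = q
      · simp only [D', hi, if_true]
        rw [hDF i (by simp [hi]), hi]
        exact hF q (Finset.mem_insert_self _ _)
      · simp [D', hi]
    rw [hset, measureReal_sdiff hsub (hmeas D' hD'), ih1, ih2, hprod, Finset.prod_insert hq]
    ring

/-- The probability that each cell in a family `F` depending on the allocation of the points to the
cells contains a point outside the core. -/
lemma measure_forall_exists_notMem_core_le (P : Measure X) [IsProbabilityMeasure P] {J : Type*}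
    [Countable J] [DecidableEq J] {idx : X → J} (hidx : ∀ q, MeasurableSet (idx ⁻¹' {q})) {core : Set X}
    (hcore : MeasurableSet core) {β ε κ : ℝ} (hβ0 : 0 ≤ β) (hβ1 : β ≤ 1) (F : (ι → J) → Finset J)
    (hF : ∀ a, ∀ q ∈ F a, P.real (idx ⁻¹' {q} ∩ core) = β * P.real (idx ⁻¹' {q}))
    (hε : 0 ≤ ε)
    (hFε : ∀ a, ∀ q ∈ F a, ε ≤ β ^ (Finset.univ.filter fun i => a i = q).card) :
    (Measure.pi fun _ : ι => P) {x | κ ≤ (F fun i => idx (x i)).card ∧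
        ∀ q ∈ F fun i => idx (x i), ∃ i, idx (x i) = q ∧ x i ∉ core} ≤
      ENNReal.ofReal (Real.exp (-(ε * κ))) := by
  set μ := Measure.pi fun _ : ι => P
  set S := {x : ι → X | κ ≤ (F fun i => idx (x i)).card ∧
        ∀ q ∈ F fun i => idx (x i), ∃ i, idx (x i) = q ∧ x i ∉ core}
  let alloc : (ι → J) → Set (ι → X) := fun a => {x | ∀ i, x i ∈ idx ⁻¹' {a i}}
  have halloc : ∀ a, MeasurableSet (alloc a) := fun a => by
    have : alloc a = ⋂ i, (fun x => x i) ⁻¹' (idx ⁻¹' {a i}) := by ext; simp [alloc]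
    rw [this]
    exact MeasurableSet.iInter fun i => measurable_pi_apply i (hidx _)
  have hmem : ∀ x a, x ∈ alloc a ↔ (fun i => idx (x i)) = a := fun x a => by
    simp [alloc, funext_iff]
  have hdisj : Pairwise (Function.onFun Disjoint alloc) := fun a b hab =>
    Set.disjoint_left.2 fun x ha hb => hab (((hmem x a).1 ha).symm.trans ((hmem x b).1 hb))
  have hcover : (⋃ a, alloc a) = Set.univ :=
    Set.eq_univ_of_forall fun x => Set.mem_iUnion.2 ⟨_, (hmem x _).2 rfl⟩
  -- Given the allocation of points to cells, the family `F a` is fixed and its cells are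
  -- independent.
  have hpiece : ∀ a, μ (S ∩ alloc a) ≤ ENNReal.ofReal (Real.exp (-(ε * κ))) * μ (alloc a) := by
    intro a
    by_cases hκ : κ ≤ (F a).card
    · have hsub : S ∩ alloc a ⊆ {x | (∀ i, x i ∈ idx ⁻¹' {a i}) ∧
          ∀ q ∈ F a, ∃ i, a i = q ∧ x i ∉ core} := by
        rintro x ⟨hx, ha⟩
        refine ⟨ha, ?_⟩
        have h2 := hx.2
        have e := (hmem x a).1 ha
        rw [e] at h2
        intro q hq
        obtain ⟨i, hi, hxi⟩ := h2 q hq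
        exact ⟨i, by rw [← hi, ← e], hxi⟩
      refine (measure_mono hsub).trans ?_
      rw [← ofReal_measureReal (μ := μ) (s := alloc a), ← ENNReal.ofReal_mul (Real.exp_nonneg _),
        ← ofReal_measureReal]
      refine ENNReal.ofReal_le_ofReal ?_
      rw [measureReal_allocated P hcore a (F a) (hF a) _ (fun i => hidx _) (fun _ _ => rfl),
        measureReal_pi_box, mul_comm]
      refine mul_le_mul_of_nonneg_right ?_ (Finset.prod_nonneg fun _ _ => measureReal_nonneg)
      calc ∏ q ∈ F a, (1 - β ^ (Finset.univ.filter fun i => a i = q).card)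
          ≤ ∏ q ∈ F a, Real.exp (-ε) := by
            refine Finset.prod_le_prod (fun q _ => sub_nonneg.2 (pow_le_one₀ hβ0 hβ1)) ?_
            intro q hq
            linarith [hFε a q hq, Real.add_one_le_exp (-ε)]
        _ = Real.exp (-(ε * (F a).card)) := by
            rw [Finset.prod_const, ← Real.exp_nat_mul]; ring_nf
        _ ≤ Real.exp (-(ε * κ)) := by gcongr
    · have : S ∩ alloc a = ∅ := by
        refine Set.eq_empty_of_forall_notMem fun x ⟨hx, ha⟩ => hκ ?_
        have h1 := hx.1
        rwa [(hmem x a).1 ha] at h1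
      simp [this]
  calc μ S = μ (⋃ a, S ∩ alloc a) := by rw [← Set.inter_iUnion, hcover, Set.inter_univ]
    _ ≤ ∑' a, μ (S ∩ alloc a) := measure_iUnion_le _
    _ ≤ ∑' a, ENNReal.ofReal (Real.exp (-(ε * κ))) * μ (alloc a) := ENNReal.tsum_le_tsum hpiece
    _ = ENNReal.ofReal (Real.exp (-(ε * κ))) := by
        rw [ENNReal.tsum_mul_left, ← measure_iUnion hdisj halloc, hcover, measure_univ, mul_one]

end Occupancy

/-! ### The square grid -/

section Grid

/-- The index of the square of side `s` that contains `y`, in the grid with vertex `c`. -/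
def cellIndex (c : Plane) (s : ℝ) (y : Plane) : ℤ × ℤ :=
  (⌊(y 0 - c 0) / s⌋, ⌊(y 1 - c 1) / s⌋)

/-- The points at distance at least `η s` from the grid lines. -/
def core (c : Plane) (s η : ℝ) : Set Plane :=
  {y | ∀ k, η ≤ Int.fract ((y k - c k) / s) ∧ Int.fract ((y k - c k) / s) < 1 - η}

lemma volume_box (a b : Fin 2 → ℝ) :
    volume {y : Plane | ∀ k, a k ≤ y k ∧ y k < b k} =
      ENNReal.ofReal (b 0 - a 0) * ENNReal.ofReal (b 1 - a 1) := by
  have h := (PiLp.volume_preserving_ofLp (Fin 2)).measure_preimage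
    (s := Set.univ.pi fun k => Set.Ico (a k) (b k))
    (MeasurableSet.univ_pi fun k => measurableSet_Ico).nullMeasurableSet
  rw [Real.volume_pi_Ico, Fin.prod_univ_two] at h
  rw [← h]
  congr 1
  ext y
  simp

lemma measurableSet_box (a b : Fin 2 → ℝ) :
    MeasurableSet {y : Plane | ∀ k, a k ≤ y k ∧ y k < b k} := by
  have : {y : Plane | ∀ k, a k ≤ y k ∧ y k < b k} =
      ⋂ k, (fun y : Plane => y k) ⁻¹' Set.Ico (a k) (b k) := by ext; simp
  rw [this]
  exact MeasurableSet.iInter fun k =>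
    (EuclideanSpace.proj (𝕜 := ℝ) k).continuous.measurable measurableSet_Ico

/-- The coordinates of a cell index. -/
def cellCoord (q : ℤ × ℤ) : Fin 2 → ℤ := ![q.1, q.2]

lemma cellIndex_eq_iff {c : Plane} {s : ℝ} (hs : 0 < s) {y : Plane} {q : ℤ × ℤ} :
    cellIndex c s y = q ↔
      ∀ k, c k + s * cellCoord q k ≤ y k ∧ y k < c k + s * (cellCoord q k + 1) := by
  have key : ∀ (u v : ℝ) (m : ℤ), ⌊(u - v) / s⌋ = m ↔ v + s * m ≤ u ∧ u < v + s * (m + 1) := by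
    intro u v m
    rw [Int.floor_eq_iff, le_div_iff₀ hs, div_lt_iff₀ hs]
    constructor <;> rintro ⟨h1, h2⟩ <;> constructor <;> linarith
  rw [cellIndex, Prod.ext_iff, Fin.forall_fin_two, key, key]
  rfl

lemma mem_core_iff {c : Plane} {s η : ℝ} (hs : 0 < s) {y : Plane} {q : ℤ × ℤ}
    (hη : 0 ≤ η) : (cellIndex c s y = q ∧ y ∈ core c s η) ↔
      ∀ k, c k + s * (cellCoord q k + η) ≤ y k ∧ y k < c k + s * (cellCoord q k + 1 - η) := by
  have key : ∀ (u v : ℝ) (m : ℤ), (v + s * m ≤ u ∧ u < v + s * (m + 1)) →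
      ((η ≤ Int.fract ((u - v) / s) ∧ Int.fract ((u - v) / s) < 1 - η) ↔
        (v + s * (m + η) ≤ u ∧ u < v + s * (m + 1 - η))) := by
    intro u v m h
    have hfl : ⌊(u - v) / s⌋ = m := by
      rw [Int.floor_eq_iff, le_div_iff₀ hs, div_lt_iff₀ hs]
      constructor <;> linarith
    rw [Int.fract, hfl, le_sub_iff_add_le, le_div_iff₀ hs, sub_lt_iff_lt_add, div_lt_iff₀ hs]
    constructor <;> rintro ⟨h1, h2⟩ <;> constructor <;> linarith
  constructor
  · rintro ⟨h1, h2⟩ k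
    exact (key _ _ _ ((cellIndex_eq_iff hs).1 h1 k)).1 (h2 k)
  · intro h
    have h1 : ∀ k, c k + s * cellCoord q k ≤ y k ∧ y k < c k + s * (cellCoord q k + 1) := by
      intro k
      have := mul_nonneg hs.le hη
      constructor <;> nlinarith [h k]
    exact ⟨(cellIndex_eq_iff hs).2 h1, fun k => (key _ _ _ (h1 k)).2 (h k)⟩

lemma preimage_cellIndex (c : Plane) {s : ℝ} (hs : 0 < s) (q : ℤ × ℤ) :
    cellIndex c s ⁻¹' {q} =
      {y | ∀ k, c k + s * cellCoord q k ≤ y k ∧ y k < c k + s * (cellCoord q k + 1)} := by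
  ext y; exact cellIndex_eq_iff hs

lemma preimage_cellIndex_inter_core (c : Plane) {s η : ℝ} (hs : 0 < s) (hη : 0 ≤ η)
    (q : ℤ × ℤ) : cellIndex c s ⁻¹' {q} ∩ core c s η =
      {y | ∀ k, c k + s * (cellCoord q k + η) ≤ y k ∧
        y k < c k + s * (cellCoord q k + 1 - η)} := by
  ext y; exact mem_core_iff hs hη

lemma measurableSet_preimage_cellIndex (c : Plane) {s : ℝ} (hs : 0 < s) (q : ℤ × ℤ) :
    MeasurableSet (cellIndex c s ⁻¹' {q}) := by
  rw [preimage_cellIndex c hs]; exact measurableSet_box _ _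

lemma measurableSet_core (c : Plane) (s η : ℝ) : MeasurableSet (core c s η) := by
  have : core c s η = ⋂ k, ((fun y : Plane => Int.fract ((y k - c k) / s)) ⁻¹'
      Set.Ico η (1 - η)) := by ext; simp [core]
  rw [this]
  refine MeasurableSet.iInter fun k => Measurable.comp measurable_fract ?_ measurableSet_Ico
  exact (((EuclideanSpace.proj (𝕜 := ℝ) k).continuous.measurable).sub_const _).div_const _

lemma volume_real_cell (c : Plane) {s : ℝ} (hs : 0 < s) (q : ℤ × ℤ) :
    volume.real (cellIndex c s ⁻¹' {q}) = s ^ 2 := by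
  rw [preimage_cellIndex c hs, Measure.real, volume_box, ENNReal.toReal_mul,
    ENNReal.toReal_ofReal (by linarith), ENNReal.toReal_ofReal (by linarith)]
  ring

lemma volume_real_cell_inter_core (c : Plane) {s η : ℝ} (hs : 0 < s) (hη : 0 ≤ η)
    (hη' : η ≤ 1 / 2) (q : ℤ × ℤ) :
    volume.real (cellIndex c s ⁻¹' {q} ∩ core c s η) = (1 - 2 * η) ^ 2 * s ^ 2 := by
  have h : 0 ≤ s * (1 - 2 * η) := mul_nonneg hs.le (by linarith)
  rw [preimage_cellIndex_inter_core c hs hη, Measure.real, volume_box, ENNReal.toReal_mul,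
    ENNReal.toReal_ofReal (by linarith), ENNReal.toReal_ofReal (by linarith)]
  ring

lemma abs_coord_sub_le_dist (y y' : Plane) (k : Fin 2) : |y k - y' k| ≤ dist y y' := by
  rw [dist_eq_norm]
  simpa using PiLp.norm_apply_le (y - y') k

lemma dist_lt_of_coord {y y' : Plane} {r : ℝ} (hr : 0 < r)
    (h : ∀ k, |y k - y' k| ≤ r) : dist y y' < 2 * r := by
  rw [EuclideanSpace.dist_eq, Real.sqrt_lt' (by positivity), Fin.sum_univ_two, Real.dist_eq,
    Real.dist_eq]
  have h0 := pow_le_pow_left₀ (abs_nonneg _) (h 0) 2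
  have h1 := pow_le_pow_left₀ (abs_nonneg _) (h 1) 2
  nlinarith [sq_nonneg r, pow_pos hr 2]

lemma dist_lt_of_cellIndex_eq {c : Plane} {s : ℝ} (hs : 0 < s) {y y' : Plane}
    (h : cellIndex c s y = cellIndex c s y') : dist y y' < 2 * s := by
  refine dist_lt_of_coord hs fun k => ?_
  have h1 := (cellIndex_eq_iff hs).1 h k
  have h2 := (cellIndex_eq_iff hs).1 (rfl : cellIndex c s y' = _) k
  rw [abs_le]
  constructor <;> linarith

lemma preimage_cellIndex_subset_ball {c : Plane} {s L : ℝ} (hs : 0 < s) {y : Plane}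
    (h : dist y c ≤ L - 2 * s) :
    cellIndex c s ⁻¹' {cellIndex c s y} ⊆ Metric.ball c L := fun y' hy' => by
  have h1 := dist_lt_of_cellIndex_eq hs (Set.mem_singleton_iff.1 hy')
  have h2 := dist_triangle y' y c
  rw [Metric.mem_ball]
  linarith

lemma mul_le_dist_of_mem_core {c : Plane} {s η : ℝ} (hs : 0 < s) (hη : 0 ≤ η) {y y' : Plane}
    (hy : y ∈ core c s η) (h : cellIndex c s y' ≠ cellIndex c s y) : η * s ≤ dist y y' := by
  have h1 := (mem_core_iff hs hη).1 ⟨rfl, hy⟩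
  rw [Ne, cellIndex_eq_iff hs, not_forall] at h
  obtain ⟨k, hk⟩ := h
  refine le_trans ?_ (abs_coord_sub_le_dist y y' k)
  have h2 := h1 k
  rw [not_and_or, not_le, not_lt] at hk
  rcases hk with hk | hk
  · refine le_trans ?_ (le_abs_self _); linarith
  · refine le_trans ?_ (neg_le_abs _); linarith

lemma finite_cells (c : Plane) {s : ℝ} (hs : 0 < s) (L : ℝ) :
    {q : ℤ × ℤ | cellIndex c s ⁻¹' {q} ⊆ Metric.ball c L}.Finite := by
  refine ((Finset.Icc (-⌈L / s⌉) ⌈L / s⌉) ×ˢ (Finset.Icc (-⌈L / s⌉) ⌈L / s⌉)).finite_toSet.subset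
    fun q hq => ?_
  have hcorner : (WithLp.toLp 2 fun k => c k + s * cellCoord q k : Plane) ∈ Metric.ball c L := by
    refine hq ((cellIndex_eq_iff hs).2 fun k => ?_)
    constructor <;> simp only <;> linarith
  have key : ∀ k, -⌈L / s⌉ ≤ cellCoord q k ∧ cellCoord q k ≤ ⌈L / s⌉ := by
    intro k
    have h := (abs_coord_sub_le_dist _ _ k).trans_lt (Metric.mem_ball.1 hcorner)
    simp only [add_sub_cancel_left] at h
    rw [abs_mul, abs_of_pos hs, ← lt_div_iff₀' hs] at h
    have h2 := abs_lt.1 (h.trans_le (Int.le_ceil (L / s)))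
    constructor
    · exact_mod_cast h2.1.le
    · exact_mod_cast h2.2.le
  have k0 := key 0
  have k1 := key 1
  simp only [cellCoord, Matrix.cons_val_zero, Matrix.cons_val_one] at k0 k1
  exact Finset.mem_coe.2 (Finset.mem_product.2 ⟨Finset.mem_Icc.2 k0, Finset.mem_Icc.2 k1⟩)

/-- The cells contained in the disk. -/
def innerCells (c : Plane) {s : ℝ} (hs : 0 < s) (L : ℝ) : Finset (ℤ × ℤ) :=
  (finite_cells c hs L).toFinset

lemma mem_innerCells {c : Plane} {s : ℝ} {hs : 0 < s} {L : ℝ} {q : ℤ × ℤ} :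
    q ∈ innerCells c hs L ↔ cellIndex c s ⁻¹' {q} ⊆ Metric.ball c L :=
  (finite_cells c hs L).mem_toFinset

/-- With `k = ⌊L / (2 s)⌋`, the `2k × 2k` block of cells around the centre fits in the disk, and `2
k ≥ L / (2 s)` because `L / (2 s) ≥ 2`. -/
lemma le_card_innerCells (c : Plane) {s : ℝ} (hs : 0 < s) {L : ℝ} (hL : 4 * s ≤ L) :
    (L / (2 * s)) ^ 2 ≤ (innerCells c hs L).card := by
  set k := ⌊L / (2 * s)⌋ with hk
  have hx : 2 ≤ L / (2 * s) := by rw [le_div_iff₀ (by positivity)]; linarith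
  have hk1 : (k : ℝ) ≤ L / (2 * s) := Int.floor_le _
  have hk2 : L / (2 * s) < k + 1 := Int.lt_floor_add_one _
  have hk0 : 0 ≤ k := Int.floor_nonneg.2 (by linarith)
  have hks : (k : ℝ) * s ≤ L / 2 := by
    rw [le_div_iff₀ (by positivity)] at hk1; linarith
  have hsub : Finset.Ico (-k) k ×ˢ Finset.Ico (-k) k ⊆ innerCells c hs L := by
    intro q hq
    rw [mem_innerCells]
    intro y hy
    have hy' := (cellIndex_eq_iff hs).1 hy
    simp only [Finset.mem_product, Finset.mem_Ico] at hq
    have hqk : ∀ j, -k ≤ cellCoord q j ∧ cellCoord q j < k := by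
      rw [Fin.forall_fin_two]; exact hq
    rw [Metric.mem_ball, show L = 2 * (L / 2) by ring]
    refine dist_lt_of_coord (by linarith) fun j => ?_
    have h1 : (-k : ℝ) ≤ cellCoord q j := by exact_mod_cast (hqk j).1
    have h2 : (cellCoord q j : ℝ) + 1 ≤ k := by exact_mod_cast (hqk j).2
    have h3 := mul_le_mul_of_nonneg_left h1 hs.le
    have h4 := mul_le_mul_of_nonneg_left h2 hs.le
    rw [abs_le]
    constructor <;> linarith [hy' j]
  have hcard := Finset.card_le_card hsub
  rw [Finset.card_product, Int.card_Ico] at hcard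
  have h3 : (((k - -k).toNat : ℕ) : ℝ) = 2 * k := by
    have : (((k - -k).toNat : ℕ) : ℤ) = 2 * k := by omega
    exact_mod_cast this
  have h4 : (2 * k : ℝ) * (2 * k) ≤ (innerCells c hs L).card := by
    rw [← h3]; exact_mod_cast hcard
  refine le_trans ?_ h4
  rw [sq]
  exact mul_self_le_mul_self (by linarith) (by linarith)

end Grid

/-! ### Uniform points in a disk -/

section Disk

/-- The uniform distribution in a disk. -/
abbrev diskLaw (c : Plane) (L : ℝ) : Measure Plane := ProbabilityTheory.cond volume (Metric.ball c L)

lemma volume_real_ball (c : Plane) {L : ℝ} (hL : 0 ≤ L) :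
    volume.real (Metric.ball c L) = Real.pi * L ^ 2 := by
  rw [Measure.real, EuclideanSpace.volume_ball_fin_two]
  simp [ENNReal.toReal_ofReal hL, mul_comm, Real.pi_pos.le]

lemma isProbabilityMeasure_diskLaw (c : Plane) {L : ℝ} (hL : 0 < L) :
    IsProbabilityMeasure (diskLaw c L) :=
  ProbabilityTheory.cond_isProbabilityMeasure_of_finite
    (Metric.measure_ball_pos volume c hL).ne' Metric.isBounded_ball.measure_lt_top.ne

lemma diskLaw_real (c : Plane) {L : ℝ} (hL : 0 < L) {A : Set Plane} (hA : A ⊆ Metric.ball c L) :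
    (diskLaw c L).real A = volume.real A / (Real.pi * L ^ 2) := by
  rw [Measure.real, ProbabilityTheory.cond_apply measurableSet_ball, Set.inter_eq_right.2 hA,
    ENNReal.toReal_mul, ENNReal.toReal_inv, ← volume_real_ball c hL.le, div_eq_inv_mul]
  rfl

lemma diskLaw_real_cell (c : Plane) {s L : ℝ} (hs : 0 < s) (hL : 0 < L) {q : ℤ × ℤ}
    (hq : q ∈ innerCells c hs L) :
    (diskLaw c L).real (cellIndex c s ⁻¹' {q}) = s ^ 2 / (Real.pi * L ^ 2) := by
  rw [diskLaw_real c hL (mem_innerCells.1 hq), volume_real_cell c hs]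

lemma diskLaw_real_cell_inter_core (c : Plane) {s L η : ℝ} (hs : 0 < s) (hL : 0 < L)
    (hη : 0 ≤ η) (hη' : η ≤ 1 / 2) {q : ℤ × ℤ} (hq : q ∈ innerCells c hs L) :
    (diskLaw c L).real (cellIndex c s ⁻¹' {q} ∩ core c s η) =
      (1 - 2 * η) ^ 2 * (diskLaw c L).real (cellIndex c s ⁻¹' {q}) := by
  rw [diskLaw_real_cell c hs hL hq, diskLaw_real c hL
    (Set.inter_subset_left.trans (mem_innerCells.1 hq)), volume_real_cell_inter_core c hs hη hη']
  ring

lemma pairwise_disjoint_cells (c : Plane) (s : ℝ) :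
    Pairwise (Function.onFun Disjoint fun q => cellIndex c s ⁻¹' {q}) := fun _ _ h =>
  Disjoint.preimage _ (Set.disjoint_singleton.2 h)

lemma card_innerCells_mul_le (c : Plane) {s L : ℝ} (hs : 0 < s) (hL : 0 < L) :
    (innerCells c hs L).card * s ^ 2 ≤ Real.pi * L ^ 2 := by
  have := isProbabilityMeasure_diskLaw c hL
  have h := measureReal_le_one (μ := diskLaw c L)
    (s := ⋃ q ∈ innerCells c hs L, cellIndex c s ⁻¹' {q})
  rw [measureReal_biUnion_finset (fun a _ b _ hab => pairwise_disjoint_cells c s hab)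
    (fun q _ => measurableSet_preimage_cellIndex c hs q),
    Finset.sum_congr rfl fun q hq => diskLaw_real_cell c hs hL hq, Finset.sum_const,
    nsmul_eq_mul, ← mul_div_assoc, div_le_one (by positivity)] at h
  exact h

end Disk

/-! ### Configurations with few empty cells -/

section FewVoids

variable {n : ℕ}

/-- At least `z` of the cells in the disk contain no robot. -/
def ManyVoids (c : Plane) {s : ℝ} (hs : 0 < s) (L : ℝ) (z : ℕ) (x : Configuration n) : Prop :=
  ∃ S ⊆ innerCells c hs L, S.card = z ∧ ∀ q ∈ S, ∀ i, x i ∉ cellIndex c s ⁻¹' {q}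

/-- Some cell in the disk contains a robot, and all its robots are in the core. -/
def HasIsolatedCell (c : Plane) {s : ℝ} (hs : 0 < s) (L η : ℝ) (x : Configuration n) : Prop :=
  ∃ q ∈ innerCells c hs L, (∃ i, cellIndex c s (x i) = q) ∧
    ∀ i, cellIndex c s (x i) = q → x i ∈ core c s η

/-- Put `z` waypoints at spacing `4 s` on the segment from `j` to `i`, starting at distance `12 z s`
from `j`, and contract them towards the centre by `1 - 2 s / L`. Their cells then lie inside the
disk, and they stay at least `2 s` apart, hence in distinct cells. One of these cells holds a robot,
which is within `4 s` of its uncontracted waypoint: it is near enough to `j` and at least `R = 4 z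
s` closer to `i`. -/
lemma hasHops_of_not_manyVoids {c : Plane} {s L : ℝ} {hs : 0 < s} (hL : 4 * s ≤ L) {z : ℕ}
    {x : Configuration n} (hz : 1 ≤ z)
    (hx : ∀ i, x i ∈ Metric.ball c L) (h : ¬ ManyVoids c hs L z x) {R : ℝ≥0}
    (hR : (R : ℝ) = 4 * z * s) : HasHops x R := by
  intro j i hji
  have hℓ : 5 * (4 * z * s) < dist (x j) (x i) := by
    rw [← NNReal.coe_lt_coe] at hji; push_cast at hji; rwa [hR] at hji
  have hL0 : 0 < L := by linarith
  have hz' : (1 : ℝ) ≤ z := by exact_mod_cast hz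
  have hzs : s ≤ z * s := le_mul_of_one_le_left hs.le hz'
  set ℓ := dist (x j) (x i) with hℓdef
  have hℓ0 : 0 < ℓ := by nlinarith
  let t : ℕ → ℝ := fun k => (12 * z * s + 4 * s * k) / ℓ
  let w : ℕ → Plane := fun k => AffineMap.lineMap (x j) (x i) (t k)
  let v : ℕ → Plane := fun k => AffineMap.lineMap c (w k) (1 - 2 * s / L)
  have h2s : 2 * s / L ≤ 1 / 2 := by rw [div_le_iff₀ hL0]; linarith
  have h2s0 : 0 ≤ 2 * s / L := by positivity
  have ht0 : ∀ k, 0 ≤ t k := fun k => by positivity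
  have ht : ∀ k < z, t k * ℓ + 4 * s ≤ 16 * z * s := fun k hk => by
    have : (k : ℝ) + 1 ≤ z := by exact_mod_cast hk
    simp only [t]
    rw [div_mul_cancel₀ _ hℓ0.ne']
    nlinarith
  have ht1 : ∀ k < z, t k ≤ 1 := fun k hk => by
    have := ht k hk
    by_contra! hc
    nlinarith
  have hw : ∀ k < z, dist (w k) c ≤ L := fun k hk => by
    have := (convex_ball c L).lineMap_mem (hx j) (hx i) ⟨ht0 k, ht1 k hk⟩
    exact (Metric.mem_ball.1 this).le
  have hvc : ∀ k < z, dist (v k) c ≤ L - 2 * s := fun k hk => by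
    simp only [v]
    rw [dist_lineMap_left, Real.norm_of_nonneg (by linarith)]
    calc (1 - 2 * s / L) * dist c (w k) ≤ (1 - 2 * s / L) * L := by
          rw [dist_comm]; gcongr
          · linarith
          · exact hw k hk
      _ = L - 2 * s := by field_simp
  have hvw : ∀ k < z, dist (v k) (w k) ≤ 2 * s := fun k hk => by
    simp only [v]
    rw [dist_lineMap_right, sub_sub_cancel, Real.norm_of_nonneg h2s0]
    calc 2 * s / L * dist c (w k) ≤ 2 * s / L * L := by
          rw [dist_comm]; gcongr; exact hw k hk
      _ = 2 * s := by field_simp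
  have hww : ∀ k l, dist (w k) (w l) = 4 * s * |(k : ℝ) - l| := fun k l => by
    simp only [w]
    rw [dist_lineMap_lineMap, Real.dist_eq, ← hℓdef]
    simp only [t]
    rw [← sub_div, abs_div, abs_of_pos hℓ0, div_mul_cancel₀ _ hℓ0.ne',
      show 12 * z * s + 4 * s * k - (12 * z * s + 4 * s * l) = 4 * s * ((k : ℝ) - l) by ring,
      abs_mul, abs_of_pos (by positivity)]
  have hvv : ∀ k l, k ≠ l → 2 * s ≤ dist (v k) (v l) := fun k l hkl => by
    have e : v k - v l = (1 - 2 * s / L) • (w k - w l) := by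
      simp only [v, AffineMap.lineMap_apply_module]
      module
    rw [dist_eq_norm, e, norm_smul, ← dist_eq_norm (w k), hww, Real.norm_of_nonneg (by linarith)]
    have : (1 : ℝ) ≤ |(k : ℝ) - l| := by
      have h1 : (1 : ℤ) ≤ |(k : ℤ) - l| := Int.one_le_abs (by omega)
      exact_mod_cast h1
    nlinarith [mul_le_mul_of_nonneg_left this hs.le]
  have hinj : Set.InjOn (fun k => cellIndex c s (v k)) (Finset.range z : Set ℕ) := by
    intro k _ l _ hkl
    by_contra hne
    exact (dist_lt_of_cellIndex_eq hs hkl).not_ge (hvv k l hne)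
  have hex : ∃ k < z, ∃ r, cellIndex c s (x r) = cellIndex c s (v k) := by
    by_contra! hc
    refine h ⟨(Finset.range z).image fun k => cellIndex c s (v k), ?_, ?_, ?_⟩
    · intro q hq
      obtain ⟨k, hk, rfl⟩ := Finset.mem_image.1 hq
      exact mem_innerCells.2 (preimage_cellIndex_subset_ball hs (hvc k (Finset.mem_range.1 hk)))
    · rw [Finset.card_image_of_injOn hinj, Finset.card_range]
    · intro q hq r hr
      obtain ⟨k, hk, rfl⟩ := Finset.mem_image.1 hq
      exact hc k (Finset.mem_range.1 hk) r hr
  obtain ⟨k, hk, r, hr⟩ := hex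
  have d1 := dist_lt_of_cellIndex_eq hs hr
  have d2 := hvw k hk
  have d3 : dist (x j) (w k) = t k * ℓ := by
    simp only [w]
    rw [dist_left_lineMap, Real.norm_of_nonneg (ht0 k)]
  have d4 : dist (w k) (x i) = (1 - t k) * ℓ := by
    simp only [w]
    rw [dist_lineMap_right, Real.norm_of_nonneg (by linarith [ht1 k hk])]
  have d5 : 12 * z * s ≤ t k * ℓ := by
    simp only [t]
    rw [div_mul_cancel₀ _ hℓ0.ne']
    have : 0 ≤ 4 * s * (k : ℝ) := by positivity
    linarith
  have d6 : dist (x r) (w k) ≤ 4 * s := by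
    have := dist_triangle (x r) (v k) (w k); linarith
  refine ⟨r, ?_, ?_⟩
  · rw [← NNReal.coe_le_coe]
    push_cast
    rw [hR]
    have := dist_triangle (x j) (w k) (x r)
    rw [dist_comm (w k)] at this
    nlinarith [ht k hk]
  · rw [← NNReal.coe_le_coe]
    push_cast
    rw [hR, ← hℓdef]
    have := dist_triangle (x r) (w k) (x i)
    nlinarith

/-- The cut separates the robots of the isolated cell from the rest. It is nontrivial, since
otherwise all other inner cells, at least `z` of them, would be empty. -/
lemma le_cutValue_of_hasIsolatedCell {c : Plane} {s L η : ℝ} {hs : 0 < s} (hη : 0 ≤ η) {z : ℕ}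
    {x : Configuration n} (hz : z < (innerCells c hs L).card) (h : ¬ ManyVoids c hs L z x)
    (hi : HasIsolatedCell c hs L η x) : η * s ≤ cutValue x := by
  obtain ⟨q, hq, ⟨i, hiq⟩, hcore⟩ := hi
  have hb : (0 : ℝ) ≤ η * s := mul_nonneg hη hs.le
  have := le_cutValue (x := x) (U := {i | cellIndex c s (x i) = q}) (r := (η * s).toNNReal)
    ⟨i, hiq⟩ ?_ ?_
  · exact Real.toNNReal_le_iff_le_coe.1 this
  · rw [Set.ne_univ_iff_exists_notMem]
    by_contra! hall
    obtain ⟨S, hS, hcard⟩ := Finset.exists_subset_card_eq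
      (s := (innerCells c hs L).erase q) (n := z) (by rw [Finset.card_erase_of_mem hq]; omega)
    refine h ⟨S, hS.trans (Finset.erase_subset _ _), hcard, fun r hr k hk => ?_⟩
    exact Finset.ne_of_mem_erase (hS hr) ((Set.mem_singleton_iff.1 hk).symm.trans (hall k))
  · intro a ha b hb
    rw [Real.toNNReal_le_iff_le_coe, coe_nndist]
    refine mul_le_dist_of_mem_core hs hη (hcore a ha) ?_
    intro hab
    exact hb (hab.trans ha)

end FewVoids

/-! ### Random deployments -/

section Deployment

lemma isProbabilityMeasure_uniformDeployment (n : ℕ) (c : Plane) {L : ℝ} (hL : 0 < L) :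
    IsProbabilityMeasure (uniformDeployment n c L) := by
  have := isProbabilityMeasure_diskLaw c hL
  unfold uniformDeployment
  infer_instance

lemma ae_forall_mem_ball (n : ℕ) (c : Plane) {L : ℝ} (hL : 0 < L) :
    ∀ᵐ x ∂(uniformDeployment n c L), ∀ i, x i ∈ Metric.ball c L := by
  have := isProbabilityMeasure_diskLaw c hL
  rw [ae_all_iff]
  intro i
  have h : ∀ᵐ y ∂(diskLaw c L), y ∈ Metric.ball c L :=
    ProbabilityTheory.ae_cond_mem measurableSet_ball
  exact (measurePreserving_eval (fun _ : Fin (n + 1) => diskLaw c L) i).quasiMeasurePreserving.ae h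

/-- There are at most `n + 1 ≤ exp (ℓ / 8)` cells, and `exp (-ℓ / π) ≤ exp (-0.31 ℓ)` is the cost of
each void. The 200th power of the product is `exp (-37 ℓ)`. -/
lemma measure_manyVoids_le (n : ℕ) (c : Plane) {s L ℓ : ℝ} (hs : 0 < s) (hL : 0 < L)
    (hℓ : s ^ 2 * (n + 1) = ℓ * L ^ 2) (hπ : Real.pi ≤ ℓ) (hlog : 8 * Real.log (n + 1) ≤ ℓ) :
    uniformDeployment n c L {x | ManyVoids c hs L 200 x} ≤
      ENNReal.ofReal (Real.exp (-(33 * ℓ))) := by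
  have := isProbabilityMeasure_diskLaw c hL
  have := isProbabilityMeasure_uniformDeployment n c hL
  have hn : (0 : ℝ) < n + 1 := by positivity
  have hpi := Real.pi_pos
  have hcard : ((innerCells c hs L).card : ℝ) ≤ n + 1 := by
    have h := card_innerCells_mul_le c hs hL
    have h1 : (innerCells c hs L).card * s ^ 2 ≤ (n + 1) * s ^ 2 := by
      calc _ ≤ Real.pi * L ^ 2 := h
        _ ≤ ℓ * L ^ 2 := by gcongr
        _ = (n + 1) * s ^ 2 := by rw [← hℓ]; ring
    exact le_of_mul_le_mul_right h1 (by positivity)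
  have hN : (n + 1 : ℝ) ≤ Real.exp (ℓ / 8) := by
    rw [← Real.log_le_iff_le_exp hn]; linarith
  have h := measureReal_void_le (ι := Fin (n + 1)) (diskLaw c L) (innerCells c hs L)
    (measurableSet_preimage_cellIndex c hs) (pairwise_disjoint_cells c s)
    (fun q hq => diskLaw_real_cell c hs hL hq) 200
  change (uniformDeployment n c L).real {x | ManyVoids c hs L 200 x} ≤ _ at h
  rw [← ofReal_measureReal]
  refine ENNReal.ofReal_le_ofReal (h.trans ?_)
  have he : s ^ 2 / (Real.pi * L ^ 2) * (Fintype.card (Fin (n + 1)) : ℝ) = ℓ / Real.pi := by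
    rw [Fintype.card_fin]
    push_cast
    rw [div_mul_eq_mul_div, hℓ]
    field_simp
  have hexp : (0.31 : ℝ) * ℓ ≤ ℓ / Real.pi := by
    rw [le_div_iff₀ hpi]
    nlinarith [Real.pi_lt_d2]
  rw [he]
  calc ((innerCells c hs L).card * Real.exp (-(ℓ / Real.pi))) ^ 200
      ≤ (Real.exp (ℓ / 8) * Real.exp (-(0.31 * ℓ))) ^ 200 := by
        gcongr
        exact hcard.trans hN
    _ = Real.exp (-(37 * ℓ)) := by
        rw [← Real.exp_add, ← Real.exp_nat_mul]; congr 1; push_cast; ring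
    _ ≤ Real.exp (-(33 * ℓ)) := by
        gcongr
        · linarith
        · norm_num

/-- At least half of the cells hold at most twice the average number of points. -/
lemma card_filter_le_of_average {ι J : Type*} [Fintype ι] [DecidableEq J] (Q : Finset J)
    (a : ι → J) {T : ℝ} (hT : 0 < T) (hQ : 2 * (Fintype.card ι : ℝ) ≤ T * Q.card) :
    ((Q.filter fun q => ¬ ((Finset.univ.filter fun i => a i = q).card : ℝ) ≤ T).card : ℝ) ≤
      Q.card / 2 := by
  classical
  set H := Q.filter fun q => ¬ ((Finset.univ.filter fun i => a i = q).card : ℝ) ≤ T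
  have h1 : T * H.card ≤ ∑ q ∈ H, ((Finset.univ.filter fun i => a i = q).card : ℝ) := by
    rw [mul_comm, ← nsmul_eq_mul]
    exact Finset.card_nsmul_le_sum _ _ _ fun q hq => (not_le.1 (Finset.mem_filter.1 hq).2).le
  have h2 : ∑ q ∈ H, ((Finset.univ.filter fun i => a i = q).card : ℝ) ≤ Fintype.card ι := by
    rw [← Nat.cast_sum, Nat.cast_le,
      ← Finset.card_biUnion (fun p _ q _ hpq => Finset.disjoint_filter.2
        fun i _ hp hq => hpq (hp.symm.trans hq))]
    exact Finset.card_le_univ _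
  rw [le_div_iff₀ two_pos]
  nlinarith

/-- At least half of the inner cells hold at most `8 ℓ` robots and fewer than 200 are empty, so a
quarter of them are occupied and light. Given the allocation, each of these is isolated
independently with probability at least `exp (-ℓ / 32)`. -/
lemma measure_not_hasIsolatedCell_le (n : ℕ) (c : Plane) {s L ℓ : ℝ} (hs : 0 < s)
    (hsL : 4 * s ≤ L) (hℓ : s ^ 2 * (n + 1) = ℓ * L ^ 2) (hℓ0 : 0 < ℓ)
    (hN1 : 3200 * ℓ ≤ n + 1)
    (hN2 : 33 * ℓ ≤ Real.exp (-(ℓ / 32)) * ((n + 1) / (16 * ℓ))) :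
    uniformDeployment n c L
        {x | ¬ ManyVoids c hs L 200 x ∧ ¬ HasIsolatedCell c hs L (1 / 2000) x} ≤
      ENNReal.ofReal (Real.exp (-(33 * ℓ))) := by
  classical
  have hL : 0 < L := by linarith
  have := isProbabilityMeasure_diskLaw c hL
  set Q := innerCells c hs L with hQdef
  set ε := Real.exp (-(ℓ / 32)) with hε
  set β : ℝ := (1 - 2 * (1 / 2000)) ^ 2 with hβ
  have hm : (n + 1 : ℝ) / (4 * ℓ) ≤ Q.card := by
    have h := le_card_innerCells c hs hsL
    have e : (n + 1 : ℝ) / (4 * ℓ) = (L / (2 * s)) ^ 2 := by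
      field_simp
      nlinarith
    rwa [e]
  have hm800 : (800 : ℝ) ≤ Q.card := by
    refine le_trans ?_ hm
    rw [le_div_iff₀ (by positivity)]
    linarith
  let F : (Fin (n + 1) → ℤ × ℤ) → Finset (ℤ × ℤ) := fun a =>
    Q.filter fun q => (∃ i, a i = q) ∧
      ((Finset.univ.filter fun i => a i = q).card : ℝ) ≤ 8 * ℓ
  have hFQ : ∀ a, ∀ q ∈ F a, q ∈ Q := fun a q hq => (Finset.mem_filter.1 hq).1
  -- The margin `1 / 2000` is chosen so that `8 ℓ` robots all fall in the core with probability at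
  -- least `exp (-8 ℓ / 256)`.
  have hβε : Real.exp (-(1 / 256)) ≤ β := by
    have h1 := Real.add_one_le_exp (1 / 256 : ℝ)
    rw [Real.exp_neg]
    refine (inv_anti₀ (by norm_num) h1).trans ?_
    rw [hβ]; norm_num
  have key := measure_forall_exists_notMem_core_le (ι := Fin (n + 1)) (diskLaw c L)
    (idx := cellIndex c s) (core := core c s (1 / 2000)) (β := β) (ε := ε)
    (κ := (Q.card : ℝ) / 4)
    (measurableSet_preimage_cellIndex c hs) (measurableSet_core c s _) (by rw [hβ]; positivity)
    (by rw [hβ]; norm_num) F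
    (fun a q hq => diskLaw_real_cell_inter_core c hs hL (by norm_num) (by norm_num) (hFQ a q hq))
    (Real.exp_nonneg _) (fun a q hq => by
      have h1 := (Finset.mem_filter.1 hq).2.2
      calc ε ≤ Real.exp (-(1 / 256)) ^ (Finset.univ.filter fun i => a i = q).card := by
            rw [hε, ← Real.exp_nat_mul]
            gcongr
            linarith
        _ ≤ _ := by gcongr)
  change uniformDeployment n c L _ ≤ _ at key
  refine (measure_mono ?_).trans (key.trans ?_)
  · rintro x ⟨hvoid, hiso⟩
    refine ⟨?_, ?_⟩
    · set a : Fin (n + 1) → ℤ × ℤ := fun i => cellIndex c s (x i) with ha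
      have hcover : Q ⊆ F a ∪ (Q.filter fun q => ∀ i, a i ≠ q) ∪
          (Q.filter fun q => ¬ ((Finset.univ.filter fun i => a i = q).card : ℝ) ≤ 8 * ℓ) := by
        intro q hq
        simp only [F, Finset.mem_union, Finset.mem_filter, hq, true_and]
        by_cases h1 : ∃ i, a i = q
        · by_cases h2 : ((Finset.univ.filter fun i => a i = q).card : ℝ) ≤ 8 * ℓ
          · exact Or.inl (Or.inl ⟨h1, h2⟩)
          · exact Or.inr h2
        · exact Or.inl (Or.inr (not_exists.1 h1))
      have hempty : (Q.filter fun q => ∀ i, a i ≠ q).card < 200 := by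
        by_contra! hc
        obtain ⟨S, hS, hcard⟩ := Finset.exists_subset_card_eq hc
        exact hvoid ⟨S, hS.trans (Finset.filter_subset _ _), hcard,
          fun q hq i hi => (Finset.mem_filter.1 (hS hq)).2 i hi⟩
      have hheavy := card_filter_le_of_average Q a (T := 8 * ℓ) (by positivity) (by
        rw [Fintype.card_fin]
        push_cast
        rw [div_le_iff₀ (by positivity)] at hm
        linarith)
      have hle := (Finset.card_le_card hcover).trans
        ((Finset.card_union_le _ _).trans (add_le_add_left (Finset.card_union_le _ _) _))
      have hle' : (Q.card : ℝ) ≤ (F a).card + (Q.filter fun q => ∀ i, a i ≠ q).card +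
          (Q.filter fun q => ¬ ((Finset.univ.filter fun i => a i = q).card : ℝ) ≤ 8 * ℓ).card := by
        exact_mod_cast hle
      have hempty' : ((Q.filter fun q => ∀ i, a i ≠ q).card : ℝ) ≤ 200 := by
        exact_mod_cast hempty.le
      linarith
    · intro q hq
      have hq' := Finset.mem_filter.1 hq
      by_contra! hc
      exact hiso ⟨q, hq'.1, hq'.2.1, hc⟩
  · refine ENNReal.ofReal_le_ofReal (Real.exp_le_exp.2 (neg_le_neg ?_))
    calc 33 * ℓ ≤ ε * ((n + 1) / (16 * ℓ)) := hN2
      _ = ε * ((n + 1) / (4 * ℓ) / 4) := by congr 1; field_simp; norm_num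
      _ ≤ ε * (Q.card / 4) := by gcongr

/-- The probability that the cost exceeds the benchmark by a large factor. -/
lemma measure_bad_le (n : ℕ) (c : Plane) {s L ℓ : ℝ} (hs : 1 ≤ s) (hsL : 100 * s ≤ L)
    (hℓ : s ^ 2 * (n + 1) = ℓ * L ^ 2) (hπ : Real.pi ≤ ℓ) (hlog : 8 * Real.log (n + 1) ≤ ℓ)
    (hcase : s = 1 ∨ (3200 * ℓ ≤ n + 1 ∧
      33 * ℓ ≤ Real.exp (-(ℓ / 32)) * ((n + 1) / (16 * ℓ)))) {C : ℝ≥0}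
    (hC : 2000 * 1600000 ≤ C) :
    uniformDeployment n c L {x | ¬ ∀ i, tagTime x i ≤ C * benchmark x} ≤
      ENNReal.ofReal (2 * Real.exp (-(33 * ℓ))) := by
  have hs0 : 0 < s := by linarith
  have hL : 0 < L := by linarith
  have hℓ0 : 0 < ℓ := Real.pi_pos.trans_le hπ
  have hball := ae_forall_mem_ball n c hL
  -- The 200 voids give `R = 800 s`. With `s ≤ 2000 * cutValue x` this yields the ratio `K = 800 *
  -- 2000`.
  set R : ℝ≥0 := Real.toNNReal (4 * (200 : ℕ) * s) with hRdef
  have hR : (R : ℝ) = 4 * (200 : ℕ) * s := Real.coe_toNNReal _ (by positivity)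
  have hR1 : 1 ≤ R := by
    rw [← NNReal.coe_le_coe, hR]; push_cast; linarith
  have good : ∀ x : Configuration n, (∀ i, x i ∈ Metric.ball c L) → ¬ ManyVoids c hs0 L 200 x →
      (1 < cutValue x → (s : ℝ) ≤ 2000 * cutValue x) → ∀ i, tagTime x i ≤ C * benchmark x := by
    intro x hx hv hcut i
    have hops := hasHops_of_not_manyVoids (by linarith) (by norm_num) hx hv hR
    refine (hops.tagTime_le_benchmark (K := 1600000) hR1 (fun h => ?_) i).trans (by gcongr)
    rw [← NNReal.coe_le_coe, hR]
    have := hcut h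
    push_cast
    linarith
  have hsum : ENNReal.ofReal (2 * Real.exp (-(33 * ℓ))) =
      ENNReal.ofReal (Real.exp (-(33 * ℓ))) + ENNReal.ofReal (Real.exp (-(33 * ℓ))) := by
    rw [← ENNReal.ofReal_add (Real.exp_nonneg _) (Real.exp_nonneg _), two_mul]
  have hv := measure_manyVoids_le n c hs0 hL hℓ hπ hlog
  -- When `s = 1` the comparison of `s` with the cut value is immediate from `1 < cutValue x`, so
  -- isolated cells are needed only in the sparse case.
  rcases hcase with h1 | ⟨h1, h2⟩
  · rw [hsum]
    refine le_trans (le_trans (measure_mono_ae ?_) hv) le_self_add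
    filter_upwards [hball] with x hx hbad
    by_contra hnv
    refine hbad (good x hx hnv fun hcut => ?_)
    have : (1 : ℝ) < cutValue x := hcut
    linarith
  · have hi := measure_not_hasIsolatedCell_le n c hs0 (by linarith) hℓ hℓ0 h1 h2
    rw [hsum]
    refine le_trans (le_trans (measure_mono_ae ?_) (measure_union_le _ _)) (add_le_add hv hi)
    filter_upwards [hball] with x hx hbad
    by_contra hcon
    have hcon' : ¬ ManyVoids c hs0 L 200 x ∧ HasIsolatedCell c hs0 L (1 / 2000) x := by
      have h3 : ¬ ManyVoids c hs0 L 200 x := fun h => hcon (Or.inl h)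
      exact ⟨h3, by_contra fun h4 => hcon (Or.inr ⟨h3, h4⟩)⟩
    refine hbad (good x hx hcon'.1 fun _ => ?_)
    have hcard : 200 < (innerCells c hs0 L).card := by
      have h := le_card_innerCells c hs0 (show 4 * s ≤ L by linarith)
      have h5 : (50 : ℝ) ≤ L / (2 * s) := by rw [le_div_iff₀ (by positivity)]; linarith
      have h6 : (200 : ℝ) < (innerCells c hs0 L).card := by nlinarith
      exact_mod_cast h6
    have := le_cutValue_of_hasIsolatedCell (by norm_num) hcard hcon'.1 hcon'.2
    linarith

/-- The benchmark is large when the leader is isolated. -/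
lemma le_lintegral_benchmark (n : ℕ) (hn : 1 ≤ n) (c : Plane) {s L ℓ : ℝ} (hs : 1 ≤ s)
    (hsL : 100 * s ≤ L) (hℓ : s ^ 2 * (n + 1) = ℓ * L ^ 2) :
    ENNReal.ofReal (6 * s ^ 2 * (s ^ 2 / L ^ 2 * Real.exp (-(32 * ℓ)))) ≤
      ∫⁻ x, (benchmark x : ℝ≥0∞) ∂(uniformDeployment n c L) := by
  have hs0 : 0 < s := by linarith
  have hL : 0 < L := by linarith
  have := isProbabilityMeasure_diskLaw c hL
  have := isProbabilityMeasure_uniformDeployment n c hL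
  -- The leader is within `s` of the centre and all others are at least `4 s` away, so the leader
  -- alone is a cut of width at least `3 s`. The benchmark is then at least `(3 s - 1) (3 s) ≥ 6 s ^
  -- 2`.
  let D : Fin (n + 1) → Set Plane :=
    Fin.cons (Metric.ball c s) fun _ => (Metric.ball c (4 * s))ᶜ
  set μ := uniformDeployment n c L with hμ
  set S : Set (Configuration n) := {x | ∀ i, x i ∈ D i} with hS
  have hSm : MeasurableSet S := by
    have : S = ⋂ i, (fun x => x i) ⁻¹' D i := by ext; simp [hS]
    rw [this]
    refine MeasurableSet.iInter fun i => measurable_pi_apply i ?_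
    refine Fin.cases ?_ (fun j => ?_) i
    · exact measurableSet_ball
    · exact measurableSet_ball.compl
  set q : ℝ := 16 * (s ^ 2 / L ^ 2) with hq
  have hπ := Real.pi_pos
  have hq1 : q ≤ 1 / 2 := by
    have h1 : s / L ≤ 1 / 100 := by rw [div_le_iff₀ hL]; linarith
    have h2 : 0 ≤ s / L := by positivity
    rw [hq, ← div_pow]
    nlinarith
  have hq0 : 0 ≤ q := by positivity
  have hprob : μ.real S = s ^ 2 / L ^ 2 * (1 - q) ^ n := by
    have h := measureReal_pi_box (diskLaw c L) D
    change μ.real S = _ at h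
    rw [h, Fin.prod_univ_succ]
    simp only [D, Fin.cons_zero, Fin.cons_succ, Finset.prod_const, Finset.card_univ,
      Fintype.card_fin]
    rw [probReal_compl_eq_one_sub measurableSet_ball,
      diskLaw_real c hL (Metric.ball_subset_ball (by linarith)),
      diskLaw_real c hL (Metric.ball_subset_ball (by linarith)), volume_real_ball c hs0.le,
      volume_real_ball c (by linarith), hq]
    have e1 : Real.pi * s ^ 2 / (Real.pi * L ^ 2) = s ^ 2 / L ^ 2 := by field_simp
    have e2 : Real.pi * (4 * s) ^ 2 / (Real.pi * L ^ 2) = 16 * (s ^ 2 / L ^ 2) := by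
      field_simp; ring
    rw [e1, e2]
  -- Here `1 - q ≥ exp (-2 q)` as `q ≤ 1 / 2`, and `q (n + 1) = 16 ℓ`.
  have hexp : Real.exp (-(32 * ℓ)) ≤ (1 - q) ^ n := by
    have h1 : Real.exp (-(2 * q)) ≤ 1 - q := by
      rw [Real.exp_neg]
      refine inv_le_of_inv_le₀ (by linarith) ?_
      refine le_trans ?_ (Real.add_one_le_exp (2 * q))
      rw [inv_le_iff_one_le_mul₀ (by linarith)]
      nlinarith
    calc Real.exp (-(32 * ℓ)) ≤ Real.exp (-(2 * q)) ^ n := by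
          rw [← Real.exp_nat_mul]
          gcongr
          have : ℓ = s ^ 2 / L ^ 2 * (n + 1) := by field_simp; linarith
          rw [this, hq]
          have : 0 ≤ s ^ 2 / L ^ 2 := by positivity
          nlinarith
      _ ≤ (1 - q) ^ n := by gcongr
  have hbench : ∀ x ∈ S, ENNReal.ofReal (6 * s ^ 2) ≤ (benchmark x : ℝ≥0∞) := by
    intro x hx
    have h0 : dist (x 0) c < s := hx 0
    have hcut : Real.toNNReal (3 * s) ≤ cutValue x := by
      refine le_cutValue (U := {0}) (Set.singleton_nonempty _) ?_ ?_
      · rw [Set.ne_univ_iff_exists_notMem]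
        refine ⟨Fin.last n, fun h => ?_⟩
        rw [Set.mem_singleton_iff, Fin.ext_iff] at h
        simp only [Fin.val_last, Fin.val_zero] at h
        omega
      · rintro _ rfl i hi
        obtain ⟨j, rfl⟩ := Fin.exists_succ_eq.2 (show i ≠ 0 from hi)
        have hj : ¬ dist (x j.succ) c < 4 * s := hx j.succ
        rw [Real.toNNReal_le_iff_le_coe, coe_nndist]
        have := dist_triangle (x j.succ) (x 0) c
        rw [dist_comm (x j.succ) (x 0)] at this
        linarith
    have hcut' : 3 * s ≤ cutValue x := Real.toNNReal_le_iff_le_coe.1 hcut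
    rw [ENNReal.ofReal, ENNReal.coe_le_coe]
    refine le_trans ?_ (cutValue_mul_le_benchmark x)
    have h1 : 1 ≤ cutValue x := by rw [← NNReal.coe_le_coe]; push_cast; linarith
    rw [Real.toNNReal_le_iff_le_coe]
    push_cast [NNReal.coe_sub h1]
    nlinarith
  calc ENNReal.ofReal (6 * s ^ 2 * (s ^ 2 / L ^ 2 * Real.exp (-(32 * ℓ))))
      ≤ ENNReal.ofReal (6 * s ^ 2) * μ S := by
        rw [ENNReal.ofReal_mul (by positivity), ← ofReal_measureReal, hprob]
        gcongr
    _ = ∫⁻ x in S, ENNReal.ofReal (6 * s ^ 2) ∂μ := (setLIntegral_const _ _).symm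
    _ ≤ ∫⁻ x in S, (benchmark x : ℝ≥0∞) ∂μ := setLIntegral_mono' hSm hbench
    _ ≤ ∫⁻ x, (benchmark x : ℝ≥0∞) ∂μ := setLIntegral_le_lintegral _ _

lemma benchmark_le_of_mem_ball {n : ℕ} {c : Plane} {L : ℝ} {x : Configuration n}
    (hx : ∀ i, x i ∈ Metric.ball c L) : (benchmark x : ℝ) ≤ 4 * L ^ 2 := by
  have hL : 0 < L := dist_nonneg.trans_lt (hx 0)
  have hd : ∀ i j, nndist (x i) (x j) ≤ Real.toNNReal (2 * L) := fun i j => by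
    rw [← NNReal.coe_le_coe, Real.coe_toNNReal _ (by linarith), coe_nndist]
    have h1 := dist_triangle_right (x i) (x j) c
    have h2 := Metric.mem_ball.1 (hx i)
    have h3 := Metric.mem_ball.1 (hx j)
    linarith
  have h1 : cutValue x ≤ Real.toNNReal (2 * L) := cutValue_le_of_forall fun U hU hU' => by
    obtain ⟨a, ha⟩ := hU
    obtain ⟨b, hb⟩ := (Set.ne_univ_iff_exists_notMem _).1 hU'
    exact (cutGap_le x ha hb).trans (hd a b)
  have h2 : maxGapTime x ≤ Real.toNNReal (2 * L) := ciSup_le fun i =>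
    (firstPassage_le_pathCost (gap x) [] i).trans (tsub_le_self.trans (hd 0 i))
  have h3 := mul_le_mul' h1 h2
  rw [← NNReal.coe_le_coe] at h3
  push_cast at h3
  rw [Real.coe_toNNReal _ (by linarith)] at h3
  rw [benchmark]
  push_cast
  linarith

end Deployment

/-! ### Choice of the grid and the passage from tail bounds to expectations -/

section Competitive

/-- For `ℓ = 8 log N` with `N = n + 1`, one has `exp (-ℓ / 32) = N ^ (-1 / 4)`, so the last
inequality compares `N ^ (3 / 4)` with a constant times `(log N) ^ 2`. -/
lemma exists_forall_log_bounds : ∃ n₀ : ℕ, ∀ n : ℕ, n₀ ≤ n →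
    1 ≤ Real.log (n + 1) ∧ 80000 * Real.log (n + 1) ≤ n + 1 ∧
      33 * (8 * Real.log (n + 1)) ≤ Real.exp (-(8 * Real.log (n + 1) / 32)) *
        ((n + 1) / (16 * (8 * Real.log (n + 1)))) := by
  have hlog : Filter.Tendsto (fun n : ℕ => Real.log ((n : ℝ) + 1)) Filter.atTop Filter.atTop :=
    Real.tendsto_log_atTop.comp
      (Filter.tendsto_atTop_add_const_right _ _ tendsto_natCast_atTop_atTop)
  have h1 := (Real.tendsto_exp_div_pow_atTop 1).eventually_ge_atTop 80000
  have h2 := ((Real.tendsto_exp_div_pow_atTop 2).comp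
    (Filter.tendsto_id.const_mul_atTop (show (0 : ℝ) < 3 / 4 by norm_num))).eventually_ge_atTop
      (33792 * (16 / 9))
  have hev := hlog.eventually ((Filter.eventually_ge_atTop 1).and (h1.and h2))
  obtain ⟨n₀, hn₀⟩ := Filter.eventually_atTop.1 hev
  refine ⟨n₀, fun n hn => ?_⟩
  obtain ⟨ha, hb, hc⟩ := hn₀ n hn
  have hN : Real.exp (Real.log ((n : ℝ) + 1)) = n + 1 := Real.exp_log (by positivity)
  set y := Real.log ((n : ℝ) + 1)
  have hy : 0 < y := by linarith
  refine ⟨ha, ?_, ?_⟩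
  · rw [pow_one, le_div_iff₀ hy, hN] at hb; exact hb
  · simp only [Function.comp, id] at hc
    rw [le_div_iff₀ (by positivity)] at hc
    have e : Real.exp (-(8 * y / 32)) * ((n + 1) / (16 * (8 * y))) =
        Real.exp (3 / 4 * y) / (128 * y) := by
      rw [← hN, mul_div_assoc', ← Real.exp_add]
      congr 1
      · congr 1; ring
      · ring
    rw [e, le_div_iff₀ (by positivity)]
    linarith

variable {n : ℕ} {c : Plane} {L : ℝ}

/-- The competitive bounds follow once configurations with a large ratio of the cost to the
benchmark are rare. -/
lemma competitive_of_measure_bad_le (hL : 0 < L) {C₁ C₂ : ℝ≥0} {B : Set (Configuration n)}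
    (hB : ∀ x ∉ B, ∀ i, tagTime x i ≤ C₁ * benchmark x)
    (h1 : n * uniformDeployment n c L B ≤ C₂)
    (h2 : n * (ENNReal.ofReal (4 * L ^ 2) * uniformDeployment n c L B) ≤
      C₂ * ∫⁻ x, (benchmark x : ℝ≥0∞) ∂(uniformDeployment n c L)) :
    upperExpectation (uniformDeployment n c L)
        (fun x => searchAlgorithm.cost x / (longestEdge x * opt x)) ≤
          ((C₁ + 36 * C₂ : ℝ≥0) : ℝ≥0∞) ∧
      upperExpectation (uniformDeployment n c L) (fun x => searchAlgorithm.cost x) ≤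
        ((C₁ + 36 * C₂ : ℝ≥0) : ℝ≥0∞) *
          ∫⁻ x, longestEdge x * opt x ∂(uniformDeployment n c L) := by
  have := isProbabilityMeasure_uniformDeployment n c hL
  set μ := uniformDeployment n c L
  -- Nothing is assumed about the measurability of `B`; its measurable hull has the same measure and
  -- gives the measurable majorant `g`, equal to `C₁` plus the worst-case factor `36 n` on the hull.
  set T := toMeasurable μ B with hT
  have hTm : MeasurableSet T := measurableSet_toMeasurable μ B
  have hBT : B ⊆ T := subset_toMeasurable μ B
  have hμT : μ T = μ B := measure_toMeasurable B
  let g : Configuration n → ℝ≥0∞ := fun x => C₁ + T.indicator (fun _ => (36 * n : ℝ≥0∞)) x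
  have hg : Measurable g := Measurable.const_add (measurable_const.indicator hTm) _
  have hbm : Measurable fun x : Configuration n => (benchmark x : ℝ≥0∞) :=
    measurable_benchmark.coe_nnreal_ennreal
  have hcost : ∀ x : Configuration n, searchAlgorithm.cost x ≤ g x * benchmark x := by
    intro x
    by_cases hx : x ∈ T
    · refine (cost_searchAlgorithm_le x (tagTime_le_benchmark x)).trans ?_
      simp only [g, Set.indicator_of_mem hx]
      push_cast
      gcongr
      exact le_add_self
    · refine (cost_searchAlgorithm_le x (hB x fun h => hx (hBT h))).trans ?_
      simp only [g, Set.indicator_of_notMem hx, add_zero]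
      push_cast
      exact le_rfl
  constructor
  · refine (iInf₂_le g hg).trans ((iInf_le _ fun x => ?_).trans ?_)
    · exact ENNReal.div_le_of_le_mul ((hcost x).trans (by gcongr; exact benchmark_le x))
    · simp only [g]
      rw [lintegral_add_left measurable_const, lintegral_const, measure_univ, mul_one,
        lintegral_indicator hTm, setLIntegral_const, hμT]
      push_cast
      gcongr _ + ?_
      rw [mul_assoc]
      gcongr
  · refine (iInf₂_le (fun x => g x * benchmark x) (hg.mul hbm)).trans
      ((iInf_le _ hcost).trans ?_)
    have hpt : ∀ x, g x * benchmark x =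
        C₁ * benchmark x + T.indicator (fun x => 36 * n * (benchmark x : ℝ≥0∞)) x := by
      intro x
      by_cases hx : x ∈ T <;> simp [g, hx, add_mul]
    have hbound : ∫⁻ x in T, (benchmark x : ℝ≥0∞) ∂μ ≤ ENNReal.ofReal (4 * L ^ 2) * μ B := by
      rw [← hμT, ← setLIntegral_const]
      refine setLIntegral_mono_ae measurable_const.aemeasurable ?_
      filter_upwards [ae_forall_mem_ball n c hL] with x hx _
      rw [← ENNReal.ofReal_coe_nnreal]
      exact ENNReal.ofReal_le_ofReal (benchmark_le_of_mem_ball hx)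
    calc ∫⁻ x, g x * benchmark x ∂μ
        = C₁ * ∫⁻ x, (benchmark x : ℝ≥0∞) ∂μ +
            36 * (n * ∫⁻ x in T, (benchmark x : ℝ≥0∞) ∂μ) := by
          simp_rw [hpt]
          rw [lintegral_add_left (hbm.const_mul _), lintegral_const_mul _ hbm,
            lintegral_indicator hTm, lintegral_const_mul _ hbm, mul_assoc]
      _ ≤ C₁ * ∫⁻ x, (benchmark x : ℝ≥0∞) ∂μ +
            36 * (C₂ * ∫⁻ x, (benchmark x : ℝ≥0∞) ∂μ) := by
          gcongr _ + 36 * ?_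
          exact le_trans (mul_le_mul_right hbound _) h2
      _ = ((C₁ + 36 * C₂ : ℝ≥0) : ℝ≥0∞) * ∫⁻ x, (benchmark x : ℝ≥0∞) ∂μ := by
          push_cast; ring
      _ ≤ _ := by
          gcongr with x
          exact benchmark_le x

/-- Vacuous: no two robots are further than `200 = 5 * 40` apart. -/
lemma hasHops_of_small_disk (hL : L ≤ 100) {x : Configuration n}
    (hx : ∀ i, x i ∈ Metric.ball c L) : HasHops x 40 := by
  intro j i hji
  exfalso
  rw [← NNReal.coe_lt_coe] at hji
  push_cast at hji
  have h1 := dist_triangle_right (x j) (x i) c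
  have h2 := Metric.mem_ball.1 (hx j)
  have h3 := Metric.mem_ball.1 (hx i)
  linarith

/-- In a large disk with many robots the side of the grid can be chosen so that the estimates of the
preceding section apply. -/
lemma exists_grid (hL : 100 < L) (hlog1 : 1 ≤ Real.log (n + 1))
    (hlog2 : 80000 * Real.log (n + 1) ≤ n + 1)
    (hlog3 : 33 * (8 * Real.log (n + 1)) ≤ Real.exp (-(8 * Real.log (n + 1) / 32)) *
        ((n + 1) / (16 * (8 * Real.log (n + 1))))) :
    ∃ s ℓ : ℝ, 1 ≤ s ∧ 100 * s ≤ L ∧ s ^ 2 * (n + 1) = ℓ * L ^ 2 ∧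
      8 * Real.log (n + 1) ≤ ℓ ∧ (s = 1 ∨ (3200 * ℓ ≤ n + 1 ∧
        33 * ℓ ≤ Real.exp (-(ℓ / 32)) * ((n + 1) / (16 * ℓ)))) := by
  set y := Real.log ((n : ℝ) + 1)
  have hN : (0 : ℝ) < n + 1 := by positivity
  have hL0 : 0 < L := by linarith
  -- In a dense deployment `s = 1` already gives `ℓ ≥ 8 log (n + 1)`. In a sparse one `s` is
  -- enlarged until `ℓ` equals `8 log (n + 1)`, the value for which the bounds on isolated cells
  -- hold.
  rcases le_total (8 * y * L ^ 2) ((n : ℝ) + 1) with h | h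
  · refine ⟨1, (n + 1) / L ^ 2, le_rfl, by linarith, by field_simp, ?_, Or.inl rfl⟩
    rwa [le_div_iff₀ (by positivity)]
  · have hnn : 0 ≤ 8 * y * L ^ 2 / (n + 1) := by positivity
    refine ⟨√(8 * y * L ^ 2 / (n + 1)), 8 * y, ?_, ?_, ?_, le_rfl, Or.inr ⟨?_, hlog3⟩⟩
    · rw [Real.one_le_sqrt, le_div_iff₀ hN]; linarith
    · rw [← le_div_iff₀' (by norm_num)]
      refine Real.sqrt_le_iff.2 ⟨by positivity, ?_⟩
      rw [div_le_iff₀ hN]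
      have := mul_le_mul_of_nonneg_right hlog2 (sq_nonneg L)
      linarith
    · rw [Real.sq_sqrt hnn]; field_simp
    · linarith

end Competitive

end ONFP

end

open ONFP in
theorem theorem2 :
    ∃ (A : ONFP.OnlineAlgorithm) (C : ℝ≥0),
      ∀ (n : ℕ) (c : ONFP.Plane) (L : ℝ), 0 < L →
        ONFP.upperExpectation (ONFP.uniformDeployment n c L)
            (fun x => A.cost x / (ONFP.longestEdge x * ONFP.opt x)) ≤ (C : ℝ≥0∞) ∧
        ONFP.upperExpectation (ONFP.uniformDeployment n c L) (fun x => A.cost x) ≤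
          (C : ℝ≥0∞) * ∫⁻ x, ONFP.longestEdge x * ONFP.opt x
            ∂(ONFP.uniformDeployment n c L) := by
  obtain ⟨n₀, hn₀⟩ := exists_forall_log_bounds
  -- The first term serves the good deployments, the second the worst-case bound for `n ≤ n₀`.
  set C₁ : ℝ≥0 := 2000 * 1600000 + 36 * n₀ with hC₁
  have hC₁' : (2000 * 1600000 : ℝ≥0) ≤ C₁ := le_self_add
  refine ⟨searchAlgorithm, C₁ + 36 * 2, fun n c L hL => ?_⟩
  rcases le_or_gt n n₀ with hn | hn
  · refine competitive_of_measure_bad_le (B := ∅) hL (fun x _ i => ?_) (by simp) (by simp)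
    refine (tagTime_le_benchmark x i).trans ?_
    gcongr
    refine le_trans ?_ (le_add_self : 36 * (n₀ : ℝ≥0) ≤ C₁)
    gcongr
  rcases le_or_gt L 100 with hL' | hL'
  · have hB : uniformDeployment n c L {x | ¬ ∀ i, x i ∈ Metric.ball c L} = 0 :=
      ae_iff.1 (ae_forall_mem_ball n c hL)
    refine competitive_of_measure_bad_le (B := {x | ¬ ∀ i, x i ∈ Metric.ball c L}) hL
      (fun x hx i => ?_) (by rw [hB]; simp) (by rw [hB]; simp)
    have hx' : ∀ i, x i ∈ Metric.ball c L := not_not.1 hx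
    refine ((hasHops_of_small_disk hL' hx').tagTime_le_benchmark (K := 1600000) (by norm_num)
      (fun h => ?_) i).trans (by gcongr)
    calc (40 : ℝ≥0) ≤ 1600000 * 1 := by norm_num
      _ ≤ 1600000 * cutValue x := by gcongr
  obtain ⟨hlog1, hlog2, hlog3⟩ := hn₀ n hn.le
  obtain ⟨s, ℓ, hs, hsL, hℓ, hlogℓ, hcase⟩ := exists_grid hL' hlog1 hlog2 hlog3
  have hπ : Real.pi ≤ ℓ := by linarith [Real.pi_lt_d2]
  have hbad := measure_bad_le n c hs hsL hℓ hπ hlogℓ hcase hC₁'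
  have hlow := le_lintegral_benchmark n (by omega) c hs hsL hℓ
  have hN : (0 : ℝ) < n + 1 := by positivity
  -- The three powers of `n + 1` come from the worst-case factor `n`, from `L ^ 2 ≤ s ^ 2 (n + 1)`,
  -- and from the probability `s ^ 2 / L ^ 2 ≥ 1 / (n + 1)` that the leader is central.
  have hN3 : ((n : ℝ) + 1) ^ 3 * Real.exp (-(33 * ℓ)) ≤ Real.exp (-(32 * ℓ)) := by
    have : ((n : ℝ) + 1) ^ 3 ≤ Real.exp ℓ := by
      rw [← Real.log_le_iff_le_exp (by positivity), Real.log_pow]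
      push_cast
      linarith
    calc ((n : ℝ) + 1) ^ 3 * Real.exp (-(33 * ℓ)) ≤ Real.exp ℓ * Real.exp (-(33 * ℓ)) := by
          gcongr
      _ = Real.exp (-(32 * ℓ)) := by rw [← Real.exp_add]; ring_nf
  have hN1 : (1 : ℝ) ≤ n + 1 := by linarith [(Nat.cast_nonneg n : (0 : ℝ) ≤ n)]
  have hnof : (n : ℝ≥0∞) = ENNReal.ofReal n := (ENNReal.ofReal_natCast n).symm
  refine competitive_of_measure_bad_le (C₂ := 2)
    (B := {x | ¬ ∀ i, tagTime x i ≤ C₁ * benchmark x}) hL (fun x hx => not_not.1 hx) ?_ ?_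
  · calc (n : ℝ≥0∞) * _ ≤ n * ENNReal.ofReal (2 * Real.exp (-(33 * ℓ))) := by gcongr
      _ = ENNReal.ofReal (n * (2 * Real.exp (-(33 * ℓ)))) := by
          rw [hnof, ← ENNReal.ofReal_mul (by positivity)]
      _ ≤ ENNReal.ofReal 2 := by
          refine ENNReal.ofReal_le_ofReal ?_
          have h1 : Real.exp (-(32 * ℓ)) ≤ 1 := Real.exp_le_one_iff.2 (by linarith [Real.pi_pos])
          have h2 : (n : ℝ) ≤ ((n : ℝ) + 1) ^ 3 := by nlinarith [sq_nonneg ((n : ℝ) + 1)]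
          have h3 := mul_le_mul_of_nonneg_right h2 (Real.exp_nonneg (-(33 * ℓ)))
          linarith
      _ = ((2 : ℝ≥0) : ℝ≥0∞) := by simp
  · have hL2 : L ^ 2 ≤ s ^ 2 * (n + 1) := by
      rw [hℓ]
      exact le_mul_of_one_le_left (by positivity) (by linarith [Real.pi_gt_three])
    have hsL2 : 1 ≤ (n + 1) * (s ^ 2 / L ^ 2) := by
      rw [mul_div_assoc', le_div_iff₀ (by positivity)]; linarith
    calc (n : ℝ≥0∞) * (ENNReal.ofReal (4 * L ^ 2) * _)
        ≤ n * (ENNReal.ofReal (4 * L ^ 2) * ENNReal.ofReal (2 * Real.exp (-(33 * ℓ)))) := by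
          gcongr
      _ = ENNReal.ofReal (n * (4 * L ^ 2 * (2 * Real.exp (-(33 * ℓ))))) := by
          rw [hnof, ← ENNReal.ofReal_mul (by positivity), ← ENNReal.ofReal_mul (by positivity)]
      _ ≤ ENNReal.ofReal (2 * (6 * s ^ 2 * (s ^ 2 / L ^ 2 * Real.exp (-(32 * ℓ))))) := by
          refine ENNReal.ofReal_le_ofReal ?_
          have he := Real.exp_nonneg (-(33 * ℓ))
          calc (n : ℝ) * (4 * L ^ 2 * (2 * Real.exp (-(33 * ℓ))))
              ≤ (n + 1) * (4 * (s ^ 2 * (n + 1)) * (2 * Real.exp (-(33 * ℓ)))) := by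
                gcongr; linarith
            _ = 8 * s ^ 2 * (((n + 1) ^ 2 * Real.exp (-(33 * ℓ))) * 1) := by ring
            _ ≤ 8 * s ^ 2 * (((n + 1) ^ 2 * Real.exp (-(33 * ℓ))) *
                  ((n + 1) * (s ^ 2 / L ^ 2))) := by gcongr
            _ = 8 * s ^ 2 * (s ^ 2 / L ^ 2 * ((n + 1) ^ 3 * Real.exp (-(33 * ℓ)))) := by ring
            _ ≤ 12 * s ^ 2 * (s ^ 2 / L ^ 2 * Real.exp (-(32 * ℓ))) := by gcongr; norm_num
            _ = _ := by ring
      _ = ((2 : ℝ≥0) : ℝ≥0∞) *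
            ENNReal.ofReal (6 * s ^ 2 * (s ^ 2 / L ^ 2 * Real.exp (-(32 * ℓ)))) := by
          rw [ENNReal.ofReal_mul (by norm_num)]; simp
      _ ≤ _ := by gcongr
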